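/- **Setting.** Each of three parties $A,B,C$ has two measurements with two outcomes; a local index is a pair (outcome, setting) $\in\{0,1\}^2$ and an event is a triple $i=(i_A,i_B,i_C)$ of local indices. Let $\mathcal I$ be a finite set of events with weights $w_i>0$. Two events are exclusive, $i\sim j$, if for some party they contain different outcomes of the same measurement. Consider the Lovász theta program: maximize $\sum_{i\in\mathcal I}w_iX_{ii}$ over complex positive semidefinite matrices $X$ indexed by $\mathcal I\cup\{0\}$ with $X_{00}=1$, $X_{ii}=X_{0i}$ for $i\in\mathcal I$, and $X_{ij}=0$ for $i\sim j$. **Reference system.** Let $\mathcal H_A,\mathcal H_B,\mathcal H_C$ be two-dimensional complex Hilbert spaces, $\psi\in\mathcal H_A\otimes\mathcal H_B\otimes\mathcal H_C$ a unit vector, and for every local index $x$ let $a_x\in\mathcal H_A$, $b_x\in\mathcal H_B$, $c_x\in\mathcal H_C$ be unit vectors such that the two vectors of the same measurement are orthogonal: $\langle a_{(0,s)},a_{(1,s)}\rangle=\langle b_{(0,s)},b_{(1,s)}\rangle=\langle c_{(0,s)},c_{(1,s)}\rangle=0$ for $s=0,1$. For $i\in\mathcal I$ let $\eta_i>0$,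 $|\theta_i|=1$ and $v_i=\theta_i\,a_{i_A}\otimes b_{i_B}\otimes c_{i_C}$; put $v_0=\psi$, $\eta_0=1$. Assume that the matrix $X^*_{ij}=\eta_i\eta_j\langle v_j,v_i\rangle$ is the unique optimal solution of the theta program, and that: 1. The vectors $v_i$, $i\in\mathcal I\cup\{0\}$, span $\mathcal H_A\otimes\mathcal H_B\otimes\mathcal H_C$. 2. There are a set $\mathcal I_A$ of two local indices and, for each $x\in\mathcal I_A$, a set $\mathcal I_{BC,x}$ of pairs of local indices, such that $\{x\}\times\mathcal I_{BC,x}\subseteq\mathcal I$ for all $x\in\mathcal I_A$, $\{a_x\}_{x\in\mathcal I_A}$ spans $\mathcal H_A$, $\{b_y\otimes c_z\}_{(y,z)\in\mathcal I_{BC,x}}$ spans $\mathcal H_B\otimes\mathcal H_C$ for each $x\in\mathcal I_A$, and the following graph on $\mathcal I_A$ is connected: distinct $x,x'$ are adjacent if there are linked $i,j,k\in\mathcal I$ with $\{i_A,j_A,k_A\}=\{x,x'\}$. Here three distinct events $i,j,k$ are *linked* if $v_i,v_j,v_k$ are pairwise non-orthogonal, each two of the events agree in exactly one of the three components, and the components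 in which the pairs $(i,j)$, $(i,k)$, $(j,k)$ agree belong to three different parties. 3. For the sets in 2, there are a set $\mathcal I_B$ of two local indices and, for each $y\in\mathcal I_B$, a set $\mathcal I_{C,y}$ of two local indices, such that $\{y\}\times\mathcal I_{C,y}\subseteq\bigcup_{x\in\mathcal I_A}\mathcal I_{BC,x}$ for all $y\in\mathcal I_B$, $\{b_y\}_{y\in\mathcal I_B}$ spans $\mathcal H_B$, $\{c_z\}_{z\in\mathcal I_{C,y}}$ spans $\mathcal H_C$ for each $y\in\mathcal I_B$, and the graph on $\mathcal I_B$ in which distinct $y,y'$ are adjacent if $\langle b_y,b_{y'}\rangle\ne0$ and $\mathcal I_{C,y}\cap\mathcal I_{C,y'}\neq\emptyset$ is connected. **Another realization.** Let $\mathcal H_A',\mathcal H_B',\mathcal H_C'$ be finite-dimensional complex Hilbert spaces, $\psi'\in\mathcal H_A'\otimes\mathcal H_B'\otimes\mathcal H_C'$ a unit vector, and for every local index $x$ let $\Pi^A_x,\Pi^B_x,\Pi^C_x$ be orthogonal projections, of arbitrary rank, on $\mathcal H_A',\mathcal H_B',\mathcal H_C'$, such that the two projections of each measurement of each party sum to the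 identity. For $i\in\mathcal I$ put $\Pi_i=\Pi^A_{i_A}\otimes\Pi^B_{i_B}\otimes\Pi^C_{i_C}$ and $v_i'=\eta_i^{-1}\Pi_i\psi'$, and put $\Pi_0=I$. Assume that the matrix $\langle\psi',\Pi_j\Pi_i\psi'\rangle$, $i,j\in\mathcal I\cup\{0\}$, is an optimal solution of the theta program. **Conclusion.** There exist finite-dimensional Hilbert spaces $\mathcal K_A,\mathcal K_B,\mathcal K_C$, isometries $V_X:\mathcal H_X\otimes\mathcal K_X\to\mathcal H_X'$ for $X=A,B,C$, and a unit vector $|junk\rangle\in\mathcal K_A\otimes\mathcal K_B\otimes\mathcal K_C$ such that, after reordering the tensor factors, $$(V_A\otimes V_B\otimes V_C)(\psi\otimes|junk\rangle)=\psi',\qquad (V_A\otimes V_B\otimes V_C)(v_i\otimes|junk\rangle)=v_i'\quad\text{for all } i\in\mathcal I.$$ -/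

import Mathlib

open scoped TensorProduct ComplexOrder InnerProductSpace

noncomputable section

/-! ### The Lovász theta semidefinite program of a weighted graph -/

/-- The feasible set of the theta program of a graph `G` on `V`. The rows and columns are
indexed by `V` together with one extra index `none` (the index `0`). -/
structure ThetaFeasible {V : Type*} [Fintype V] (G : SimpleGraph V)
    (X : Matrix (Option V) (Option V) ℂ) : Prop where
  posSemidef : X.PosSemidef
  corner : X none none = 1
  diag : ∀ i : V, X (some i) (some i) = X none (some i)
  edge : ∀ i j : V, G.Adj i j → X (some i) (some j) = 0

/-- The objective `∑ i, w i * X i i` (diagonal entries of feasible matrices are real). -/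
def thetaObjective {V : Type*} [Fintype V] (w : V → ℝ)
    (X : Matrix (Option V) (Option V) ℂ) : ℝ :=
  ∑ i : V, w i * (X (some i) (some i)).re

/-- `X` is an optimal solution of the theta program of `(G, w)`. -/
def IsThetaOptimal {V : Type*} [Fintype V] (G : SimpleGraph V) (w : V → ℝ)
    (X : Matrix (Option V) (Option V) ℂ) : Prop :=
  ThetaFeasible G X ∧ ∀ Y : Matrix (Option V) (Option V) ℂ,
    ThetaFeasible G Y → thetaObjective w Y ≤ thetaObjective w X

/-- `X` is the unique optimal solution of the theta program of `(G, w)`. -/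
def IsUniqueThetaOptimal {V : Type*} [Fintype V] (G : SimpleGraph V) (w : V → ℝ)
    (X : Matrix (Option V) (Option V) ℂ) : Prop :=
  IsThetaOptimal G w X ∧ ∀ Y : Matrix (Option V) (Option V) ℂ, IsThetaOptimal G w Y → Y = X

/-! ### Events of the scenario with two binary measurements per party -/

/-- The index of a local vector or projection of one party: a pair `(outcome, setting)`.
There are two settings with two outcomes each. -/
abbrev LocalIndex : Type := Fin 2 × Fin 2

/-- A tripartite event: every party's outcome and setting. -/
abbrev TriEvent : Type := LocalIndex × LocalIndex × LocalIndex

/-- Two local indices are different outcomes of the same measurement. -/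
def LocallyExclusive (x y : LocalIndex) : Prop := x.2 = y.2 ∧ x.1 ≠ y.1

/-- The graph of exclusivity of a set of events: two events are adjacent if, for some party,
they contain different outcomes of the same measurement. -/
def exclusivityGraph (I : Finset TriEvent) : SimpleGraph I where
  Adj i j := LocallyExclusive i.1.1 j.1.1 ∨ LocallyExclusive i.1.2.1 j.1.2.1 ∨
    LocallyExclusive i.1.2.2 j.1.2.2
  symm := ⟨fun _ _ h => h.imp (fun h => ⟨h.1.symm, h.2.symm⟩)
    (Or.imp (fun h => ⟨h.1.symm, h.2.symm⟩) (fun h => ⟨h.1.symm, h.2.symm⟩))⟩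
  loopless := ⟨fun _ h => by
    rcases h with h | h | h <;> exact h.2 rfl⟩

/-! ### Linked events and the spanning conditions on the reference vectors -/

section Conditions

variable {ιA ιB ιC : Type*} {HA HB HC : Type*}
  [NormedAddCommGroup HA] [InnerProductSpace ℂ HA]
  [NormedAddCommGroup HB] [InnerProductSpace ℂ HB]
  [NormedAddCommGroup HC] [InnerProductSpace ℂ HC]

/-- The product vector `a_{i_A} ⊗ b_{i_B} ⊗ c_{i_C}`. -/
def productVector (a : ιA → HA) (b : ιB → HB) (c : ιC → HC) (i : ιA × ιB × ιC) :
    HA ⊗[ℂ] (HB ⊗[ℂ] HC) :=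
  a i.1 ⊗ₜ[ℂ] (b i.2.1 ⊗ₜ[ℂ] c i.2.2)

/-- The three parties. -/
inductive Party : Type
  | A : Party
  | B : Party
  | C : Party

/-- `i` and `j` have the same component for the given party and different components for
both of the other parties. -/
def SharesOnly : Party → ιA × ιB × ιC → ιA × ιB × ιC → Prop
  | Party.A, i, j => i.1 = j.1 ∧ i.2.1 ≠ j.2.1 ∧ i.2.2 ≠ j.2.2
  | Party.B, i, j => i.1 ≠ j.1 ∧ i.2.1 = j.2.1 ∧ i.2.2 ≠ j.2.2
  | Party.C, i, j => i.1 ≠ j.1 ∧ i.2.1 ≠ j.2.1 ∧ i.2.2 = j.2.2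

/-- Three distinct events are linked: their vectors are pairwise non-orthogonal, every two of
them share exactly one component, and the three shared components belong to three different
parties. -/
def Linked (a : ιA → HA) (b : ιB → HB) (c : ιC → HC) (i j k : ιA × ιB × ιC) : Prop :=
  i ≠ j ∧ i ≠ k ∧ j ≠ k ∧
  ⟪productVector a b c i, productVector a b c j⟫_ℂ ≠ 0 ∧
  ⟪productVector a b c i, productVector a b c k⟫_ℂ ≠ 0 ∧
  ⟪productVector a b c j, productVector a b c k⟫_ℂ ≠ 0 ∧
  ∃ s t u : Party, s ≠ t ∧ s ≠ u ∧ t ≠ u ∧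
    SharesOnly s i j ∧ SharesOnly t i k ∧ SharesOnly u j k

/-- The graph on the indices of the first party in which two distinct indices `x`, `x'` are
joined if there are linked events `i, j, k ∈ I` whose first components are exactly
`x` and `x'`. -/
def linkGraph (I : Finset (ιA × ιB × ιC)) (a : ιA → HA) (b : ιB → HB) (c : ιC → HC) :
    SimpleGraph ιA where
  Adj x x' := x ≠ x' ∧ ∃ i ∈ I, ∃ j ∈ I, ∃ k ∈ I,
    Linked a b c i j k ∧ ({i.1, j.1, k.1} : Set ιA) = {x, x'}
  symm := ⟨fun _ _ h => ⟨h.1.symm, by rw [Set.pair_comm]; exact h.2⟩⟩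
  loopless := ⟨fun _ h => h.1 rfl⟩

/-- The first spanning condition: `{a_x}`, `x ∈ IA`, is a basis of the first space; for every
`x ∈ IA` the vectors `b_y ⊗ c_z` with `(y, z) ∈ IBC x` span the tensor product of the other two;
all the events `(x, y, z)` used here belong to `I`; and the link graph on `IA` is connected. -/
structure LinkedSpanning (I : Finset (ιA × ιB × ιC)) (a : ιA → HA) (b : ιB → HB) (c : ιC → HC)
    (IA : Finset ιA) (IBC : ιA → Finset (ιB × ιC)) : Prop where
  card_eq : IA.card = Module.finrank ℂ HA
  span_first : Submodule.span ℂ (a '' (IA : Set ιA)) = ⊤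
  span_rest : ∀ x ∈ IA,
    Submodule.span ℂ ((fun p : ιB × ιC => b p.1 ⊗ₜ[ℂ] c p.2) '' (IBC x : Set (ιB × ιC))) =
      (⊤ : Submodule ℂ (HB ⊗[ℂ] HC))
  mem_events : ∀ x ∈ IA, ∀ p ∈ IBC x, (x, p) ∈ I
  connected : ((linkGraph I a b c).induce (IA : Set ιA)).Connected

/-- The graph on the indices of the middle party in which two distinct indices `y`, `y'` are
joined if `⟨b_y, b_y'⟩ ≠ 0` and the sets `IC y`, `IC y'` have a common element. -/
def overlapGraph (b : ιB → HB) (IC : ιB → Finset ιC) : SimpleGraph ιB where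
  Adj y y' := y ≠ y' ∧ ⟪b y, b y'⟫_ℂ ≠ 0 ∧ ∃ z, z ∈ IC y ∧ z ∈ IC y'
  symm := ⟨fun _ _ h => ⟨h.1.symm, fun h0 => h.2.1 (inner_eq_zero_symm.mp h0),
    h.2.2.imp fun _ hz => ⟨hz.2, hz.1⟩⟩⟩
  loopless := ⟨fun _ h => h.1 rfl⟩

/-- The second spanning condition, for a set `J` of pairs of indices of the last two parties:
there is a set `IB` and there are sets `IC y`, `y ∈ IB`, with `{y} × IC y ⊆ J`, such that
`{b_y}`, `y ∈ IB`, is a basis, `{c_z}`, `z ∈ IC y`, is a basis for every `y ∈ IB`, and the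
overlap graph on `IB` is connected. -/
def OverlapSpanning (J : Set (ιB × ιC)) (b : ιB → HB) (c : ιC → HC) : Prop :=
  ∃ (IB : Finset ιB) (IC : ιB → Finset ιC),
    IB.card = Module.finrank ℂ HB ∧
    (∀ y ∈ IB, (IC y).card = Module.finrank ℂ HC) ∧
    (∀ y ∈ IB, ∀ z ∈ IC y, (y, z) ∈ J) ∧
    Submodule.span ℂ (b '' (IB : Set ιB)) = ⊤ ∧
    (∀ y ∈ IB, Submodule.span ℂ (c '' (IC y : Set ιC)) = ⊤) ∧
    ((overlapGraph b IC).induce (IB : Set ιB)).Connected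

/-! ### The reference Gram matrix and the matrix of a realization -/

/-- The reference vector of an event, `v_i = θ_i a_{i_A} ⊗ b_{i_B} ⊗ c_{i_C}`; the factor
`θ_i` is a phase. -/
def eventVector {I : Finset (ιA × ιB × ιC)} (θ : I → ℂ)
    (a : ιA → HA) (b : ιB → HB) (c : ιC → HC) (i : I) : HA ⊗[ℂ] (HB ⊗[ℂ] HC) :=
  θ i • productVector a b c i.1

/-- The family `(v_i)` extended by `v_0 = ψ`. -/
def withState {V H : Type*} (ψ : H) (v : V → H) : Option V → H
  | none => ψ
  | some i => v i

/-- The weights `(η_i)` extended by `η_0 = 1`. -/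
def withOne {V : Type*} (η : V → ℝ) : Option V → ℝ
  | none => 1
  | some i => η i

/-- The matrix `X_{ij} = η_i η_j ⟨v_j, v_i⟩`, with `v_0 = ψ` and `η_0 = 1`. -/
def referenceMatrix {V H : Type*} [NormedAddCommGroup H] [InnerProductSpace ℂ H]
    (ψ : H) (η : V → ℝ) (v : V → H) : Matrix (Option V) (Option V) ℂ :=
  Matrix.of fun i j =>
    (withOne η i : ℂ) * (withOne η j : ℂ) * ⟪withState ψ v j, withState ψ v i⟫_ℂ

/-- The product operator `P_{i_A} ⊗ Q_{i_B} ⊗ R_{i_C}` of an event. -/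
def productOperator (P : ιA → (HA →ₗ[ℂ] HA)) (Q : ιB → (HB →ₗ[ℂ] HB))
    (R : ιC → (HC →ₗ[ℂ] HC)) (i : ιA × ιB × ιC) :
    HA ⊗[ℂ] (HB ⊗[ℂ] HC) →ₗ[ℂ] HA ⊗[ℂ] (HB ⊗[ℂ] HC) :=
  TensorProduct.map (P i.1) (TensorProduct.map (Q i.2.1) (R i.2.2))

/-- The operators `(Π_i)` extended by `Π_0 = 1`. -/
def withIdentity {V H : Type*} [NormedAddCommGroup H] [InnerProductSpace ℂ H]
    (E : V → (H →ₗ[ℂ] H)) : Option V → (H →ₗ[ℂ] H)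
  | none => LinearMap.id
  | some i => E i

/-- The matrix `X_{ij} = ⟨ψ, Π_j Π_i ψ⟩`, with `Π_0 = 1`. -/
def realizationMatrix {V H : Type*} [NormedAddCommGroup H] [InnerProductSpace ℂ H]
    (ψ : H) (E : V → (H →ₗ[ℂ] H)) : Matrix (Option V) (Option V) ℂ :=
  Matrix.of fun i j => ⟪ψ, withIdentity E j (withIdentity E i ψ)⟫_ℂ

end Conditions

/-- A pair of binary projective measurements on `H`: `P (o, s)` is the orthogonal projection of
outcome `o` of measurement `s`, and the two projections of each measurement sum to `1`. -/
structure IsBinaryMeasurementPair {H : Type*} [NormedAddCommGroup H] [InnerProductSpace ℂ H]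
    (P : LocalIndex → (H →ₗ[ℂ] H)) : Prop where
  isProjection : ∀ x, (P x).IsSymmetricProjection
  sum_eq : ∀ s : Fin 2, P (0, s) + P (1, s) = LinearMap.id

/-- The reordering of tensor factors
`(HA ⊗ HB ⊗ HC) ⊗ (KA ⊗ KB ⊗ KC) ≃ (HA ⊗ KA) ⊗ (HB ⊗ KB) ⊗ (HC ⊗ KC)`. -/
def regroup (HA HB HC KA KB KC : Type*)
    [AddCommGroup HA] [Module ℂ HA] [AddCommGroup HB] [Module ℂ HB]
    [AddCommGroup HC] [Module ℂ HC] [AddCommGroup KA] [Module ℂ KA]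
    [AddCommGroup KB] [Module ℂ KB] [AddCommGroup KC] [Module ℂ KC] :
    (HA ⊗[ℂ] (HB ⊗[ℂ] HC)) ⊗[ℂ] (KA ⊗[ℂ] (KB ⊗[ℂ] KC)) ≃ₗ[ℂ]
      (HA ⊗[ℂ] KA) ⊗[ℂ] ((HB ⊗[ℂ] KB) ⊗[ℂ] (HC ⊗[ℂ] KC)) :=
  (TensorProduct.tensorTensorTensorComm ℂ HA (HB ⊗[ℂ] HC) KA (KB ⊗[ℂ] KC)).trans
    (TensorProduct.congr (LinearEquiv.refl ℂ (HA ⊗[ℂ] KA))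
      (TensorProduct.tensorTensorTensorComm ℂ HB HC KB KC))

end

/-! Uniqueness of the optimum `X` is used as extremality. Suppose a family satisfies the linear
constraints of the program and its Gram matrix is at most a multiple of that of the reference family
`u`. Then the remainder satisfies the constraints as well, so after normalization `X` is a convex
combination of two feasible points, and the Gram matrix of the family is a multiple of the optimal
one (`IsUniqueThetaOptimal.gram_eq`). Such families are the orbits of a vector under the event
projections `E i`. If an operator commutes with all `E i`, it maps a dominated orbit to a dominated
orbit. Polarization gives `⟪E i χ, E j χ'⟫ = ⟪χ, χ'⟫ ⟪u i, u j⟫` (`inner_orbitFamily`), the source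
of all rigidity below.

For two projections `p`, `q` the operator `T = 1 - (p - q)²` commutes with both, as in Jordan's
lemma. The state `ψ'` therefore splits into joint eigenvectors of the three local operators `T`,
each with a dominated orbit. On such a component, an operator commuting with all `E i` is built from
a rank-one operator, and the polarized identity then shows that the product of two eigenvalues is
the squared overlap of two reference events that share the third party's index
(`mul_eq_of_joint_eigenvector`). A linked triple gives all three pairwise products, hence each
eigenvalue, so `ψ'` itself is a joint eigenvector (`overlapOperator_apply`).

The eigenvalues are the squared overlaps of the reference qubit bases. They are positive by
linkedness and less than one because the reference vectors span (`overlaps_lt_one`). On such an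
eigenspace the local projections form a multiple of the qubit model (`exists_isometry`), and
flatness places `ψ'` in the tensor product of the three eigenspaces (`exists_map_eq_of_exact`).
Every slice of the resulting tensor along the multiplicity spaces has a dominated orbit in the
reference system, hence is a multiple of `ψ` (`eq_smul_state`). So the tensor is `ψ ⊗ junk`. -/

/-! ### Orbits of a vector under a family of operators -/

section Orbit

variable {V H : Type*} [NormedAddCommGroup H] [InnerProductSpace ℂ H]

/-- A vector together with its images under the given operators. -/
def orbitFamily (E : V → (H →ₗ[ℂ] H)) (χ : H) : Option V → H := fun i => withIdentity E i χ

@[simp] theorem orbitFamily_none (E : V → (H →ₗ[ℂ] H)) (χ : H) : orbitFamily E χ none = χ := rfl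

@[simp] theorem orbitFamily_some (E : V → (H →ₗ[ℂ] H)) (χ : H) (i : V) :
    orbitFamily E χ (some i) = E i χ := rfl

theorem orbitFamily_add (E : V → (H →ₗ[ℂ] H)) (χ χ' : H) :
    orbitFamily E (χ + χ') = orbitFamily E χ + orbitFamily E χ' := by
  ext i; simp [orbitFamily]

end Orbit

/-! ### Extremality of the unique optimum and its polarized form -/

section Theta

variable {V : Type*} [Fintype V] {G : SimpleGraph V} {w : V → ℝ}
  {H K L : Type*} [NormedAddCommGroup H] [InnerProductSpace ℂ H]
  [NormedAddCommGroup K] [InnerProductSpace ℂ K]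
  [NormedAddCommGroup L] [InnerProductSpace ℂ L]

/-- The family `g` is dominated by the family `u`: the Gram matrix of `g` is at most a multiple
of that of `u`. -/
def DominatedBy {ι : Type*} [Fintype ι] (u : ι → K) (g : ι → H) : Prop :=
  ∃ c : ℝ, ∀ d : ι → ℂ, ‖∑ i, d i • g i‖ ^ 2 ≤ c * ‖∑ i, d i • u i‖ ^ 2

theorem DominatedBy.posSemidef {ι : Type*} [Fintype ι] {u : ι → K} {g : ι → H}
    {c : ℝ} (h : ∀ d : ι → ℂ, ‖∑ i, d i • g i‖ ^ 2 ≤ c * ‖∑ i, d i • u i‖ ^ 2) :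
    ((c : ℂ) • Matrix.gram ℂ u - Matrix.gram ℂ g).PosSemidef := by
  refine .of_dotProduct_mulVec_nonneg (.sub (.smul (Matrix.isHermitian_gram ℂ u) ?_)
    (Matrix.isHermitian_gram ℂ g)) fun x => ?_
  · simp [IsSelfAdjoint]
  · rw [Matrix.sub_mulVec, dotProduct_sub, Matrix.smul_mulVec, dotProduct_smul,
      Matrix.star_dotProduct_gram_mulVec, Matrix.star_dotProduct_gram_mulVec,
      inner_self_eq_norm_sq_to_K, inner_self_eq_norm_sq_to_K]
    simp only [smul_eq_mul, Complex.coe_algebraMap]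
    have := h x
    rw [sub_nonneg]
    exact_mod_cast this

theorem ThetaFeasible.of_posSemidef {M : Matrix (Option V) (Option V) ℂ} (hM : M.PosSemidef)
    {p : ℝ} (hp : 0 < p) (hc : M none none = p)
    (hd : ∀ i : V, M (some i) (some i) = M none (some i))
    (he : ∀ i j : V, G.Adj i j → M (some i) (some j) = 0) :
    ThetaFeasible G ((p : ℂ)⁻¹ • M) where
  posSemidef := hM.smul (by
    rw [← Complex.ofReal_inv]
    exact_mod_cast (inv_pos.mpr hp).le)
  corner := by
    have : (p : ℂ) ≠ 0 := by exact_mod_cast hp.ne'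
    simp [hc, this]
  diag i := by simp [hd]
  edge i j h := by simp [he i j h]

theorem thetaObjective_smul_add (a b : ℝ) (X Y : Matrix (Option V) (Option V) ℂ) :
    thetaObjective w ((a : ℂ) • X + (b : ℂ) • Y) =
      a * thetaObjective w X + b * thetaObjective w Y := by
  simp only [thetaObjective, Finset.mul_sum, ← Finset.sum_add_distrib]
  refine Finset.sum_congr rfl fun i _ => ?_
  simp
  ring

/-- If a convex combination of two feasible points is the unique optimum, then both are equal to
the optimum. -/
theorem IsUniqueThetaOptimal.eq_of_convex {X Y Z : Matrix (Option V) (Option V) ℂ}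
    (hX : IsUniqueThetaOptimal G w X) (hY : ThetaFeasible G Y) (hZ : ThetaFeasible G Z)
    {a b : ℝ} (ha : 0 < a) (hb : 0 ≤ b) (hab : a + b = 1)
    (h : (a : ℂ) • Y + (b : ℂ) • Z = X) : Y = X := by
  -- The objective is linear, so if `Y` fell short of the optimum, `Z` would have to exceed it.
  refine hX.2 Y ⟨hY, fun W hW => (hX.1.2 W hW).trans ?_⟩
  have h1 := hX.1.2 Z hZ
  have h2 : thetaObjective w X = a * thetaObjective w Y + b * thetaObjective w Z := by
    rw [← h, thetaObjective_smul_add]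
  have h3 := mul_le_mul_of_nonneg_left h1 hb
  have h4 : thetaObjective w X = a * thetaObjective w X + b * thetaObjective w X := by
    rw [← add_mul, hab, one_mul]
  have h5 : a * thetaObjective w X ≤ a * thetaObjective w Y := by linarith
  exact le_of_mul_le_mul_left h5 ha

/-- The Gram matrix of a family which satisfies the linear constraints of the theta program and
is dominated by the unique optimum is a multiple of the optimum. -/
theorem IsUniqueThetaOptimal.gram_eq {u : Option V → K}
    (hX : IsUniqueThetaOptimal G w (Matrix.gram ℂ u).transpose) {g : Option V → H}
    (hd : ∀ i : V, ⟪g (some i), g (some i)⟫_ℂ = ⟪g (some i), g none⟫_ℂ)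
    (he : ∀ i j : V, G.Adj i j → ⟪g (some j), g (some i)⟫_ℂ = 0)
    (hg : DominatedBy u g) (i j : Option V) :
    ⟪g i, g j⟫_ℂ = ⟪g none, g none⟫_ℂ * ⟪u i, u j⟫_ℂ := by
  obtain ⟨c, hc⟩ := hg
  obtain ⟨hfeas, -⟩ := hX.1
  have hu0 : ⟪u none, u none⟫_ℂ = 1 := hfeas.corner
  have hu1 : ‖u none‖ ^ 2 = 1 := by
    rw [← inner_self_eq_norm_sq (𝕜 := ℂ), hu0]; simp
  classical
  have hgi : ∀ i, ‖g i‖ ^ 2 ≤ c * ‖u i‖ ^ 2 := fun i => by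
    simpa using hc (Pi.single i 1)
  -- The diagonal constraint makes every `g i` vanish together with `g none`; otherwise the corner
  -- entry is positive and can be scaled to one.
  by_cases h0 : g none = 0
  · have : ∀ i, g i = 0 := by
      rintro (_ | i)
      · exact h0
      · have := hd i
        rwa [h0, inner_zero_right, inner_self_eq_zero] at this
    simp [this]
  set p : ℝ := ‖g none‖ ^ 2 with hp
  have hp0 : 0 < p := by positivity
  -- Enlarging the constant makes the corner `c' - p` of the remainder strictly positive, so that
  -- the remainder can be normalized as well.
  set c' : ℝ := c + 1
  have hcp : p < c' := by
    have := hgi none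
    rw [hu1] at this
    simp only [c']; linarith
  have hc' : ∀ d : Option V → ℂ, ‖∑ i, d i • g i‖ ^ 2 ≤ c' * ‖∑ i, d i • u i‖ ^ 2 := fun d =>
    (hc d).trans (mul_le_mul_of_nonneg_right (by simp [c']) (by positivity))
  have hgp : ⟪g none, g none⟫_ℂ = (p : ℂ) := by
    rw [inner_self_eq_norm_sq_to_K]; simp [hp]
  have hM : ThetaFeasible G ((p : ℂ)⁻¹ • (Matrix.gram ℂ g).transpose) :=
    .of_posSemidef (Matrix.posSemidef_gram ℂ g).transpose hp0 hgp hd he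
  have hN : ThetaFeasible G (((c' - p : ℝ) : ℂ)⁻¹ •
      ((c' : ℂ) • Matrix.gram ℂ u - Matrix.gram ℂ g).transpose) := by
    refine .of_posSemidef (DominatedBy.posSemidef hc').transpose (sub_pos.mpr hcp) ?_ ?_ ?_
    · simp only [Matrix.transpose_apply, Matrix.sub_apply, Matrix.smul_apply, Matrix.gram_apply,
        hu0, hgp, smul_eq_mul]
      push_cast; ring
    · intro i
      have := hfeas.diag i
      simp only [Matrix.transpose_apply] at this
      simp only [Matrix.transpose_apply, Matrix.sub_apply, Matrix.smul_apply, this]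
      rw [Matrix.gram_apply g, Matrix.gram_apply g, hd]
    · intro i j hij
      have := hfeas.edge i j hij
      simp only [Matrix.transpose_apply] at this
      simp only [Matrix.transpose_apply, Matrix.sub_apply, Matrix.smul_apply, this]
      simp [Matrix.gram_apply, he i j hij]
  have hc0 : 0 < c' := hp0.trans hcp
  have hpC : (p : ℂ) ≠ 0 := by exact_mod_cast hp0.ne'
  have hcC : (c' : ℂ) ≠ 0 := by exact_mod_cast hc0.ne'
  have hcpC : ((c' - p : ℝ) : ℂ) ≠ 0 := by exact_mod_cast (sub_pos.mpr hcp).ne'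
  -- The optimum is the mean of the two normalized matrices with weights proportional to their
  -- corners `p` and `c' - p`.
  have key := hX.eq_of_convex hM hN (a := p / c') (b := (c' - p) / c') (by positivity)
    (div_nonneg (sub_pos.mpr hcp).le hc0.le) (by field_simp; ring) (by
      ext i j
      simp only [Matrix.add_apply, Matrix.smul_apply, Matrix.transpose_apply, Matrix.sub_apply,
        smul_eq_mul, Complex.ofReal_div]
      field_simp
      ring)
  have := congrFun (congrFun key j) i
  simp only [Matrix.smul_apply, Matrix.transpose_apply, Matrix.gram_apply, smul_eq_mul] at this
  rw [hgp, ← this]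
  field_simp

theorem DominatedBy.add {ι : Type*} [Fintype ι] {u : ι → K} {g g' : ι → H}
    (h : DominatedBy u g) (h' : DominatedBy u g') : DominatedBy u (g + g') := by
  obtain ⟨c, hc⟩ := h
  obtain ⟨c', hc'⟩ := h'
  refine ⟨2 * (c + c'), fun d => ?_⟩
  have h1 : ∑ i, d i • (g + g') i = ∑ i, d i • g i + ∑ i, d i • g' i := by
    simp [Finset.sum_add_distrib]
  have h2 := parallelogram_law_with_norm ℂ (∑ i, d i • g i) (∑ i, d i • g' i)
  rw [h1]
  nlinarith [hc d, hc' d, mul_self_nonneg ‖∑ i, d i • g i - ∑ i, d i • g' i‖]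

theorem DominatedBy.map {ι : Type*} [Fintype ι] {u : ι → K} {g : ι → H}
    (h : DominatedBy u g) (f : H →L[ℂ] L) : DominatedBy u (fun i => f (g i)) := by
  obtain ⟨c, hc⟩ := h
  refine ⟨‖f‖ ^ 2 * c, fun d => ?_⟩
  have : ∑ i, d i • f (g i) = f (∑ i, d i • g i) := by simp
  rw [this, mul_assoc]
  calc ‖f (∑ i, d i • g i)‖ ^ 2 ≤ (‖f‖ * ‖∑ i, d i • g i‖) ^ 2 := by
        gcongr; exact f.le_opNorm _
    _ ≤ _ := by rw [mul_pow]; gcongr; exact hc d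

/-- All new dominated orbits arise in this way. The intertwining relation is needed only at the
vector `χ`, which also covers maps between different systems. -/
theorem DominatedBy.orbitFamily_map {u : Option V → K} {E : V → (H →ₗ[ℂ] H)}
    {F : V → (L →ₗ[ℂ] L)} {χ : H} (h : DominatedBy u (orbitFamily E χ)) (f : H →L[ℂ] L)
    (hf : ∀ i, f (E i χ) = F i (f χ)) : DominatedBy u (orbitFamily F (f χ)) := by
  convert h.map f using 1
  funext i
  cases i with
  | none => rfl
  | some i => exact (hf i).symm

theorem DominatedBy.orbitFamily_smul {u : Option V → K} {E : V → (H →ₗ[ℂ] H)} {χ : H}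
    (h : DominatedBy u (orbitFamily E χ)) (z : ℂ) : DominatedBy u (orbitFamily E (z • χ)) :=
  h.orbitFamily_map (z • ContinuousLinearMap.id ℂ H) (fun i => by simp)

/-- Polarized form of `IsUniqueThetaOptimal.gram_eq` for the orbits of two vectors under
projections which are orthogonal along the edges of the graph. -/
theorem IsUniqueThetaOptimal.inner_orbitFamily {u : Option V → K}
    (hX : IsUniqueThetaOptimal G w (Matrix.gram ℂ u).transpose) {E : V → (H →ₗ[ℂ] H)}
    (hE : ∀ i, (E i).IsSymmetricProjection) (he : ∀ i j, G.Adj i j → E j ∘ₗ E i = 0)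
    {χ χ' : H} (h : DominatedBy u (orbitFamily E χ)) (h' : DominatedBy u (orbitFamily E χ'))
    (i j : Option V) :
    ⟪orbitFamily E χ i, orbitFamily E χ' j⟫_ℂ = ⟪χ, χ'⟫_ℂ * ⟪u i, u j⟫_ℂ := by
  have key : ∀ ξ : H, DominatedBy u (orbitFamily E ξ) →
      ⟪orbitFamily E ξ i, orbitFamily E ξ j⟫_ℂ = ⟪ξ, ξ⟫_ℂ * ⟪u i, u j⟫_ℂ := fun ξ hξ => by
    refine hX.gram_eq (fun k => ?_) (fun k l hkl => ?_) hξ i j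
    · have h1 : E k (E k ξ) = E k ξ := congrArg (fun f => f ξ) (hE k).isIdempotentElem
      have h2 := (hE k).isSymmetric (E k ξ) ξ
      rw [h1] at h2
      simpa using h2.symm
    · have h1 : E l (E k ξ) = 0 := congrArg (fun f => f ξ) (he k l hkl)
      have h2 := (hE l).isSymmetric ξ (E k ξ)
      simpa [h1] using h2
  have h1 := key _ h
  have h2 := key _ h'
  -- The diagonal identity at `χ + χ'` and at `χ + i χ'` separates the two mixed terms of the
  -- sesquilinear form.
  have h3 := key (χ + χ') (by rw [orbitFamily_add]; exact h.add h')
  have h4 := key (χ + Complex.I • χ')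
    (by rw [orbitFamily_add]; exact h.add (h'.orbitFamily_smul _))
  have h5 : orbitFamily E (Complex.I • χ') = Complex.I • orbitFamily E χ' := by
    ext i; simp [orbitFamily]
  rw [orbitFamily_add] at h3 h4
  rw [h5] at h4
  simp only [Pi.add_apply, Pi.smul_apply, inner_add_left, inner_add_right, inner_smul_left,
    inner_smul_right, Complex.conj_I] at h3 h4
  have hI : Complex.I * Complex.I = -1 := Complex.I_mul_I
  linear_combination (1 / 2 : ℂ) * (h3 - h1 - h2) - (Complex.I / 2) * (h4 - h1 - h2)
    + (1 / 2) * (⟪orbitFamily E χ i, orbitFamily E χ' j⟫_ℂ - ⟪orbitFamily E χ' i, orbitFamily E χ j⟫_ℂ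
      + (⟪χ', χ⟫_ℂ - ⟪χ, χ'⟫_ℂ) * ⟪u i, u j⟫_ℂ + Complex.I * (⟪χ', χ'⟫_ℂ * ⟪u i, u j⟫_ℂ
      - ⟪orbitFamily E χ' i, orbitFamily E χ' j⟫_ℂ)) * hI

end Theta

/-! ### Extending an element of a corner to the commutant of two idempotents -/

section Corner

variable {A : Type*} [Ring A] [Algebra ℂ A]

/-- `y` lies in the corner `r A r` and is an eigenvector of both multiplications by the compression
of `o` to this corner. In the degenerate cases `t = 0, 1` this is required of `o` itself. -/
structure CornerEigen (r o y : A) (t : ℂ) : Prop where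
  left : r * y = y
  right : y * r = y
  eig_left : r * o * y = t • y
  eig_right : y * o * r = t • y
  deg_left : t * (1 - t) = 0 → o * y = t • y
  deg_right : t * (1 - t) = 0 → y * o = t • y

/-- The extension can thus be made one party at a time: the relations for the remaining parties
survive the passage from `y` to `e`. -/
theorem CornerEigen.of_intertwining {r o q y e : A} {t : ℂ} (h : CornerEigen r o y t)
    (hr : r * q = q * r) (ho : o * q = q * o)
    (hl : ∀ (m : A) (s : ℂ), m * q = q * m → m * y = s • y → m * e = s • e)
    (hr' : ∀ (m : A) (s : ℂ), m * q = q * m → y * m = s • y → e * m = s • e) :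
    CornerEigen r o e t where
  left := by simpa using hl r 1 hr (by simpa using h.left)
  right := by simpa using hr' r 1 hr (by simpa using h.right)
  eig_left := hl _ t (by rw [mul_assoc, ho, ← mul_assoc, hr, mul_assoc]) h.eig_left
  eig_right := by
    rw [mul_assoc]
    exact hr' _ t (by rw [mul_assoc, hr, ← mul_assoc, ho, mul_assoc])
      (by rw [← mul_assoc]; exact h.eig_right)
  deg_left h0 := hl o t ho (h.deg_left h0)
  deg_right h0 := hr' o t ho (h.deg_right h0)

/-- An element of a corner which commutes with the compression of `q` extends to an element
commuting with `p` and `q`. -/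
theorem CornerEigen.exists_extension {p q y : A} {t : ℂ} (h : CornerEigen p q y t)
    (hq : q * q = q) :
    ∃ e : A, p * e = y ∧ e * p = y ∧ q * e = e * q ∧
      (∀ (m : A) (s : ℂ), m * q = q * m → m * y = s • y → m * e = s • e) ∧
      (∀ (m : A) (s : ℂ), m * q = q * m → y * m = s • y → e * m = s • e) ∧
      (∀ m : A, m * q = q * m → m * y = y * m → m * e = e * m) := by
  set c : ℂ := (t * (1 - t))⁻¹ with hc
  have h1 : p * (q * y) = t • y := by rw [← mul_assoc]; exact h.eig_left
  have h2 : y * (q * p) = t • y := by rw [← mul_assoc]; exact h.eig_right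
  have h3 : p * (q * (y * q)) = t • (y * q) := by
    rw [← mul_assoc q, ← mul_assoc p, h1, smul_mul_assoc]
  -- The bracket is `(q - t) y (q - t)`. For two projections, `q - t` carries the `t`-eigenvectors
  -- in the range of `p` into the kernel of `p` and scales squared norms by `t (1 - t)`, so the
  -- correction is a copy of `y` on that side. If `t (1 - t) = 0`, then `c = 0⁻¹ = 0` and `e = y`.
  refine ⟨y + c • (q * (y * q) - t • (q * y) - t • (y * q) + (t * t) • y), ?_, ?_, ?_, ?_, ?_, ?_⟩
  · have h4 : p * (y * q) = y * q := by rw [← mul_assoc, h.left]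
    simp only [mul_add, mul_sub, mul_smul_comm, h1, h3, h4, h.left]
    module
  · simp only [add_mul, sub_mul, smul_mul_assoc, mul_assoc, h2, h.right, mul_smul_comm]
    module
  · have h5 : q * (q * (y * q)) = q * (y * q) := by rw [← mul_assoc, hq]
    have h6 : q * (q * y) = q * y := by rw [← mul_assoc, hq]
    simp only [mul_add, mul_sub, add_mul, sub_mul, mul_smul_comm, smul_mul_assoc, mul_assoc, hq,
      h5, h6]
    by_cases h0 : t * (1 - t) = 0
    · simp [hc, h0, h.deg_left h0, h.deg_right h0]
    · have h7 : c * (t * (1 - t)) = 1 := inv_mul_cancel₀ h0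
      clear_value c
      have h8 : 1 - c * t + c * t * t = 0 := by linear_combination -h7
      trans (1 - c * t + c * t * t) • (q * y) + (c - c * t) • (q * (y * q))
      · module
      · rw [h8, zero_smul, ← zero_smul ℂ (y * q), ← h8]
        module
  all_goals intro m
  · intro s hm hy
    have h4 : m * (q * (y * q)) = s • (q * (y * q)) := by
      rw [← mul_assoc m, hm, mul_assoc, ← mul_assoc m, hy]; simp
    have h5 : m * (q * y) = s • (q * y) := by
      rw [← mul_assoc m, hm, mul_assoc, hy]; simp
    have h6 : m * (y * q) = s • (y * q) := by
      rw [← mul_assoc m, hy]; simp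
    simp only [mul_add, mul_sub, mul_smul_comm, h4, h5, h6, hy]
    module
  · intro s hm hy
    have h6 : y * (q * m) = s • (y * q) := by
      rw [← hm, ← mul_assoc, hy]; simp
    simp only [add_mul, sub_mul, smul_mul_assoc, mul_assoc, h6, hy, mul_smul_comm]
    module
  · intro hm hy
    have hm' : Commute m q := hm
    have hy' : Commute m y := hy
    exact hy'.add_right ((((hm'.mul_right (hy'.mul_right hm')).sub_right
      ((hm'.mul_right hy').smul_right t)).sub_right ((hy'.mul_right hm').smul_right t)).add_right
      (hy'.smul_right _) |>.smul_right c)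

/-- The version of `CornerEigen.exists_extension` for three commuting pairs. -/
theorem exists_extension_of_cornerEigen {r₁ o₁ r₂ o₂ r₃ o₃ y : A} {t₁ t₂ t₃ : ℂ}
    (ho₁ : o₁ * o₁ = o₁) (ho₂ : o₂ * o₂ = o₂) (ho₃ : o₃ * o₃ = o₃)
    (h12 : Commute r₁ r₂ ∧ Commute r₁ o₂ ∧ Commute o₁ r₂ ∧ Commute o₁ o₂)
    (h13 : Commute r₁ r₃ ∧ Commute r₁ o₃ ∧ Commute o₁ r₃ ∧ Commute o₁ o₃)
    (h23 : Commute r₂ r₃ ∧ Commute r₂ o₃ ∧ Commute o₂ r₃ ∧ Commute o₂ o₃)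
    (h₁ : CornerEigen r₁ o₁ y t₁) (h₂ : CornerEigen r₂ o₂ y t₂) (h₃ : CornerEigen r₃ o₃ y t₃) :
    ∃ e : A, Commute e r₁ ∧ Commute e o₁ ∧ Commute e r₂ ∧ Commute e o₂ ∧
      Commute e r₃ ∧ Commute e o₃ ∧ e * (r₁ * r₂ * r₃) = y := by
  obtain ⟨e₁, a1, b1, c1, l1, m1, n1⟩ := h₁.exists_extension ho₁
  have h₂' := h₂.of_intertwining h12.2.2.1.symm.eq h12.2.2.2.symm.eq l1 m1
  have h₃' := h₃.of_intertwining h13.2.2.1.symm.eq h13.2.2.2.symm.eq l1 m1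
  obtain ⟨e₂, a2, b2, c2, l2, m2, n2⟩ := h₂'.exists_extension ho₂
  have h₃'' := h₃'.of_intertwining h23.2.2.1.symm.eq h23.2.2.2.symm.eq l2 m2
  obtain ⟨e₃, a3, b3, c3, l3, m3, n3⟩ := h₃''.exists_extension ho₃
  -- An extension keeps the commutation with the pairs already treated, since these commute with the
  -- next pair.
  have k1 : Commute e₂ r₁ := (n2 r₁ h12.2.1.eq (a1.trans b1.symm)).symm
  have k2 : Commute e₂ o₁ := (n2 o₁ h12.2.2.2.eq c1).symm
  have k3 : Commute e₂ r₂ := b2.trans a2.symm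
  refine ⟨e₃, (n3 r₁ h13.2.1.eq k1.symm.eq).symm, (n3 o₁ h13.2.2.2.eq k2.symm.eq).symm,
    (n3 r₂ h23.2.1.eq k3.symm.eq).symm, (n3 o₂ h23.2.2.2.eq c2).symm, b3.trans a3.symm, c3.symm, ?_⟩
  rw [(h13.1.mul_left h23.1).eq, ← mul_assoc, b3, h12.1.eq, ← mul_assoc, b2, b1]

end Corner

/-! ### The overlap operator of two projections -/

section Jordan

variable {H : Type*} [NormedAddCommGroup H] [InnerProductSpace ℂ H]

/-- The operator `1 - (p - q)²` of two projections, which commutes with both of them. -/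
def overlapOperator (p q : Module.End ℂ H) : Module.End ℂ H := 1 - (p - q) * (p - q)

theorem overlapOperator_comm (p q : Module.End ℂ H) :
    overlapOperator p q = overlapOperator q p := by
  simp only [overlapOperator]
  noncomm_ring

theorem overlapOperator_eq {p q : Module.End ℂ H} (hp : p * p = p) (hq : q * q = q) :
    overlapOperator p q = 1 - p - q + p * q + q * p := by
  simp only [overlapOperator, mul_sub, sub_mul, hp, hq]
  abel

/-- Both products are equal to `p q p`. -/
theorem commute_overlapOperator_left {p q : Module.End ℂ H} (hp : p * p = p) (hq : q * q = q) :
    Commute (overlapOperator p q) p := by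
  rw [overlapOperator_eq hp hq, commute_iff_eq]
  simp only [add_mul, sub_mul, mul_add, mul_sub, one_mul, mul_one, mul_assoc, hp]
  simp only [← mul_assoc, hp]
  abel

theorem commute_overlapOperator_right {p q : Module.End ℂ H} (hp : p * p = p) (hq : q * q = q) :
    Commute (overlapOperator p q) q := by
  rw [overlapOperator_comm]
  exact commute_overlapOperator_left hq hp

theorem Commute.overlapOperator {p q e : Module.End ℂ H} (hp : Commute e p) (hq : Commute e q) :
    Commute e (overlapOperator p q) :=
  (Commute.one_right e).sub_right ((hp.sub_right hq).mul_right (hp.sub_right hq))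

theorem isSymmetric_overlapOperator {p q : Module.End ℂ H} (hp : p.IsSymmetric)
    (hq : q.IsSymmetric) : (overlapOperator p q).IsSymmetric := fun x y => by
  have h := hp.sub hq
  simp only [_root_.overlapOperator, LinearMap.sub_apply, Module.End.one_apply,
    Module.End.mul_apply, inner_sub_left, inner_sub_right]
  have h1 := h ((p - q) x) y
  have h2 := h x ((p - q) y)
  simp only [LinearMap.sub_apply, inner_sub_left, inner_sub_right] at h1 h2
  rw [h1]
  linear_combination -h2

/-- On the range of `p` the overlap operator is the compression `p q p`. -/
theorem apply_apply_of_overlapOperator {p q : Module.End ℂ H} (hp : p * p = p) (hq : q * q = q)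
    {t : ℂ} {f : H} (hf : p f = f) (ht : overlapOperator p q f = t • f) : p (q f) = t • f := by
  rw [← ht, overlapOperator_eq hp hq]
  simp [hf]

/-- The rank-one operator `|f⟩⟨f|` on an eigenvector of the compression of `o` to `r`. -/
theorem cornerEigen_rankOne {r o : Module.End ℂ H} (hr : r.IsSymmetricProjection)
    (ho : o.IsSymmetricProjection) {t : ℝ} {f : H} (hf : r f = f)
    (ht : overlapOperator r o f = (t : ℂ) • f) :
    CornerEigen r o ((innerₛₗ ℂ f).smulRight f : Module.End ℂ H) (t : ℂ) := by
  have h1 := apply_apply_of_overlapOperator hr.isIdempotentElem ho.isIdempotentElem hf ht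
  -- The reason is the identity `‖o f - t f‖² = t (1 - t) ‖f‖²`.
  have h2 : (t : ℂ) * (1 - t) = 0 → o f = (t : ℂ) • f := fun h0 => by
    have h3 : ⟪o f, f⟫_ℂ = t * ⟪f, f⟫_ℂ := by
      rw [ho.isSymmetric]
      conv_lhs => rw [← hf, hr.isSymmetric, hf, h1, inner_smul_right]
    have h3' : ⟪f, o f⟫_ℂ = t * ⟪f, f⟫_ℂ := by rw [← ho.isSymmetric, h3]
    have h4 : ⟪o f, o f⟫_ℂ = t * ⟪f, f⟫_ℂ := by
      rw [ho.isSymmetric, ← Module.End.mul_apply, ho.isIdempotentElem.eq, h3']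
    rw [← sub_eq_zero, ← inner_self_eq_zero (𝕜 := ℂ)]
    simp only [inner_sub_left, inner_sub_right, inner_smul_left, inner_smul_right, h3, h3', h4,
      Complex.conj_ofReal]
    linear_combination ⟪f, f⟫_ℂ * h0
  refine ⟨?_, ?_, ?_, ?_, fun h0 => ?_, fun h0 => ?_⟩
  all_goals ext x
  · simp [hf]
  · simp [← hr.isSymmetric f x, hf]
  · simp only [Module.End.mul_apply, LinearMap.smulRight_apply, map_smul, h1, LinearMap.smul_apply]
    exact smul_comm _ _ _
  · have : ⟪f, o (r x)⟫_ℂ = t * ⟪f, x⟫_ℂ := by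
      rw [← ho.isSymmetric, ← hr.isSymmetric, h1, inner_smul_left, Complex.conj_ofReal]
    simp [this, mul_smul]
  · simp only [Module.End.mul_apply, LinearMap.smulRight_apply, map_smul, h2 h0,
      LinearMap.smul_apply]
    exact smul_comm _ _ _
  · have : ⟪f, o x⟫_ℂ = t * ⟪f, x⟫_ℂ := by
      rw [← ho.isSymmetric, h2 h0, inner_smul_left, Complex.conj_ofReal]
    simp [this, mul_smul]

end Jordan

/-! ### Eigenvalue products on a joint eigenvector -/

section Overlap

variable {V : Type*} [Fintype V] {G : SimpleGraph V} {w : V → ℝ}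
  {H K : Type*} [NormedAddCommGroup H] [InnerProductSpace ℂ H] [FiniteDimensional ℂ H]
  [NormedAddCommGroup K] [InnerProductSpace ℂ K]

/-- In an optimal realization whose state is a joint eigenvector of the overlap operators, the
eigenvalues are determined by the optimal Gram matrix: for two events which share exactly one
local projection the product of the other two eigenvalues is the squared normalized overlap. -/
theorem IsUniqueThetaOptimal.mul_eq_of_joint_eigenvector {u : Option V → K}
    (hX : IsUniqueThetaOptimal G w (Matrix.gram ℂ u).transpose) {E : V → Module.End ℂ H}
    (hE : ∀ i, (E i).IsSymmetricProjection) (he : ∀ i j, G.Adj i j → E j ∘ₗ E i = 0)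
    {r₁ o₁ r₂ o₂ r₃ o₃ : Module.End ℂ H}
    (hr₁ : r₁.IsSymmetricProjection) (ho₁ : o₁.IsSymmetricProjection)
    (hr₂ : r₂.IsSymmetricProjection) (ho₂ : o₂.IsSymmetricProjection)
    (hr₃ : r₃.IsSymmetricProjection) (ho₃ : o₃.IsSymmetricProjection)
    (h12 : Commute r₁ r₂ ∧ Commute r₁ o₂ ∧ Commute o₁ r₂ ∧ Commute o₁ o₂)
    (h13 : Commute r₁ r₃ ∧ Commute r₁ o₃ ∧ Commute o₁ r₃ ∧ Commute o₁ o₃)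
    (h23 : Commute r₂ r₃ ∧ Commute r₂ o₃ ∧ Commute o₂ r₃ ∧ Commute o₂ o₃)
    (hcomm : ∀ e : Module.End ℂ H, Commute e r₁ → Commute e o₁ → Commute e r₂ → Commute e o₂ →
      Commute e r₃ → Commute e o₃ → ∀ k, Commute e (E k))
    {i j : V} (hi : E i = r₁ * o₂ * o₃) (hj : E j = r₁ * r₂ * r₃)
    {χ : H} (hχ : DominatedBy u (orbitFamily E χ)) (hχ0 : χ ≠ 0) {t₁ t₂ t₃ : ℝ}
    (ht₁ : overlapOperator r₁ o₁ χ = (t₁ : ℂ) • χ)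
    (ht₂ : overlapOperator r₂ o₂ χ = (t₂ : ℂ) • χ)
    (ht₃ : overlapOperator r₃ o₃ χ = (t₃ : ℂ) • χ)
    (hij : ⟪u (some j), u (some i)⟫_ℂ ≠ 0) :
    t₂ * t₃ * (‖u (some i)‖ ^ 2 * ‖u (some j)‖ ^ 2) =
      ‖⟪u (some j), u (some i)⟫_ℂ‖ ^ 2 := by
  have ir₁ := hr₁.isIdempotentElem.eq
  have io₁ := ho₁.isIdempotentElem.eq
  have ir₂ := hr₂.isIdempotentElem.eq
  have io₂ := ho₂.isIdempotentElem.eq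
  have ir₃ := hr₃.isIdempotentElem.eq
  have io₃ := ho₃.isIdempotentElem.eq
  have T₁r : Commute (overlapOperator r₁ o₁) r₁ := commute_overlapOperator_left ir₁ io₁
  have T₁ : ∀ k, Commute (overlapOperator r₁ o₁) (E k) := hcomm _ T₁r
    (commute_overlapOperator_right ir₁ io₁)
    (Commute.overlapOperator h12.1.symm h12.2.2.1.symm).symm
    (Commute.overlapOperator h12.2.1.symm h12.2.2.2.symm).symm
    (Commute.overlapOperator h13.1.symm h13.2.2.1.symm).symm
    (Commute.overlapOperator h13.2.1.symm h13.2.2.2.symm).symm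
  have T₂ : ∀ k, Commute (overlapOperator r₂ o₂) (E k) := hcomm _
    (Commute.overlapOperator h12.1 h12.2.1).symm
    (Commute.overlapOperator h12.2.2.1 h12.2.2.2).symm
    (commute_overlapOperator_left ir₂ io₂) (commute_overlapOperator_right ir₂ io₂)
    (Commute.overlapOperator h23.1.symm h23.2.2.1.symm).symm
    (Commute.overlapOperator h23.2.1.symm h23.2.2.2.symm).symm
  have T₃ : ∀ k, Commute (overlapOperator r₃ o₃) (E k) := hcomm _
    (Commute.overlapOperator h13.1 h13.2.1).symm
    (Commute.overlapOperator h13.2.2.1 h13.2.2.2).symm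
    (Commute.overlapOperator h23.1 h23.2.1).symm
    (Commute.overlapOperator h23.2.2.1 h23.2.2.2).symm
    (commute_overlapOperator_left ir₃ io₃) (commute_overlapOperator_right ir₃ io₃)
  have push : ∀ {T e : Module.End ℂ H} {s : ℂ} {x : H}, Commute T e → T x = s • x →
      T (e x) = s • e x := fun {T e s x} hc hx => by
    rw [← Module.End.mul_apply, hc.eq, Module.End.mul_apply, hx, map_smul]
  have fixed : ∀ {r e : Module.End ℂ H} (x : H), r * e = e → r (e x) = e x := fun {r e} x hre => by
    rw [← Module.End.mul_apply, hre]
  set g := E i χ with hg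
  -- This vector lies in the ranges of `r₁`, `r₂`, `r₃` because `E j` is their product, and it is
  -- still a joint eigenvector. Hence `|f⟩⟨f|` lies in all three corners.
  set f := E j g with hf
  have hf₁ : r₁ f = f := fixed g (by rw [hj, ← mul_assoc, ← mul_assoc, ir₁])
  have hf₂ : r₂ f = f := fixed g (by
    rw [hj, ← mul_assoc, ← mul_assoc, ← h12.1.eq, mul_assoc r₁, ir₂])
  have hf₃ : r₃ f = f := fixed g (by
    rw [hj, (h13.1.mul_left h23.1).eq, ← mul_assoc, ir₃])
  have hg₁ : r₁ g = g := fixed χ (by rw [hi, ← mul_assoc, ← mul_assoc, ir₁])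
  have hg₂ : o₂ g = g := fixed χ (by
    rw [hi, ← mul_assoc, ← mul_assoc, ← h12.2.1.eq, mul_assoc r₁, io₂])
  have hg₃ : o₃ g = g := fixed χ (by
    rw [hi, (h13.2.1.mul_left h23.2.2.2).eq, ← mul_assoc, io₃])
  have hgi : E i g = g := fixed χ (hE i).isIdempotentElem.eq
  have hfj : E j f = f := fixed g (hE j).isIdempotentElem.eq
  -- The operator `e` satisfies `e E_j = |f⟩⟨f|` and commutes with every `E k`, so the orbit of `e
  -- χ` is dominated.
  obtain ⟨e, c₁, c₂, c₃, c₄, c₅, c₆, hey⟩ := exists_extension_of_cornerEigen io₁ io₂ io₃ h12 h13 h23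
    (cornerEigen_rankOne hr₁ ho₁ hf₁ (push (T₁ j) (push (T₁ i) ht₁)))
    (cornerEigen_rankOne hr₂ ho₂ hf₂ (push (T₂ j) (push (T₂ i) ht₂)))
    (cornerEigen_rankOne hr₃ ho₃ hf₃ (push (T₃ j) (push (T₃ i) ht₃)))
  have hce := hcomm e c₁ c₂ c₃ c₄ c₅ c₆
  -- the norm of `f`
  have hEE : E i f = ((t₂ * t₃ : ℝ) : ℂ) • g := by
    -- Since `g` is fixed by `r₁`, `o₂` and `o₃`, applying `E i` and `E j` leaves only the two
    -- compressions of the unshared parties, which multiply `g` by `t₂` and `t₃`.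
    have h1 : E i f = o₂ (r₂ (o₃ (r₃ g))) := by
      have : E i * E j * r₁ = o₂ * r₂ * (o₃ * r₃) * r₁ := by
        rw [hi, hj]
        have a1 := h12.1.eq
        have a2 := h12.2.1.eq
        have a3 := h13.1.eq
        have a4 := h13.2.1.eq
        have a5 := h23.2.1.eq
        calc r₁ * o₂ * o₃ * (r₁ * r₂ * r₃) * r₁
            = r₁ * o₂ * (o₃ * r₁) * (r₂ * (r₃ * r₁)) := by simp only [mul_assoc]
          _ = (r₁ * o₂) * r₁ * (o₃ * r₂) * (r₁ * r₃) := by rw [← a3, ← a4]; simp only [mul_assoc]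
          _ = o₂ * (r₁ * r₁) * r₂ * (o₃ * r₁) * r₃ := by rw [a2, ← a5]; simp only [mul_assoc]
          _ = o₂ * (r₁ * r₂) * r₁ * o₃ * r₃ := by rw [ir₁, ← a4]; simp only [mul_assoc]
          _ = o₂ * r₂ * (r₁ * r₁) * o₃ * r₃ := by rw [a1]; simp only [mul_assoc]
          _ = o₂ * r₂ * (r₁ * o₃) * r₃ := by rw [ir₁]; simp only [mul_assoc]
          _ = o₂ * r₂ * o₃ * (r₁ * r₃) := by rw [a4]; simp only [mul_assoc]
          _ = o₂ * r₂ * (o₃ * r₃) * r₁ := by rw [a3]; simp only [mul_assoc]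
      have := congrArg (fun F => F g) this
      simpa [hg₁] using this
    have h3 : o₃ (r₃ g) = (t₃ : ℂ) • g := apply_apply_of_overlapOperator io₃ ir₃ hg₃
      (by rw [overlapOperator_comm]; exact push (T₃ i) ht₃)
    have h2 : o₂ (r₂ g) = (t₂ : ℂ) • g := apply_apply_of_overlapOperator io₂ ir₂ hg₂
      (by rw [overlapOperator_comm]; exact push (T₂ i) ht₂)
    rw [h1, h3, map_smul, map_smul, h2, smul_smul]
    push_cast
    rw [mul_comm]
  have hff : ⟪f, f⟫_ℂ = ((t₂ * t₃ : ℝ) : ℂ) * ⟪g, g⟫_ℂ := by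
    rw [← inner_smul_right, ← hEE, ← (hE i).isSymmetric, hgi, hf, (hE j).isSymmetric, ← hf, hfj]
  -- polarized optimality for `χ` and `e χ`
  have heχ : DominatedBy u (orbitFamily E (e χ)) :=
    hχ.orbitFamily_map (LinearMap.toContinuousLinearMap e) fun k => by
      simpa using congrArg (fun F => F χ) (hce k).eq
  have hB := hX.inner_orbitFamily hE he heχ hχ (some j) (some i)
  have hA := hX.inner_orbitFamily hE he heχ hχ (some j) (some j)
  have hC := hX.inner_orbitFamily hE he hχ hχ (some j) (some i)
  have hD := hX.inner_orbitFamily hE he hχ hχ (some i) (some i)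
  simp only [orbitFamily_some] at hA hB hC hD
  rw [← hg] at hB hC hD
  have hEe : E j (e χ) = ⟪f, χ⟫_ℂ • f := by
    have h1 := congrArg (fun F => F χ) (hce j).eq
    have h2 := congrArg (fun F => F χ) hey
    rw [← hj] at h2
    simp only [Module.End.mul_apply] at h1 h2
    rw [← h1, h2]
    simp
  set γ := ⟪f, χ⟫_ℂ with hγ
  have hγ1 : ⟪f, E j χ⟫_ℂ = γ := by rw [← (hE j).isSymmetric, hfj]
  have hγ2 : ⟪E j χ, g⟫_ℂ = (starRingEnd ℂ) γ := by
    rw [hγ, hf, (hE j).isSymmetric, inner_conj_symm]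
  have hfg : ⟪f, g⟫_ℂ = ⟪f, f⟫_ℂ := by
    conv_lhs => rw [← hfj, (hE j).isSymmetric, ← hf]
  rw [hEe, inner_smul_left] at hA hB
  rw [hγ1] at hA
  rw [hfg, hff, hD] at hB
  rw [hγ2] at hC
  set U := ⟪u (some j), u (some i)⟫_ℂ with hU
  set N := ⟪χ, χ⟫_ℂ with hN
  have hN0 : N ≠ 0 := by rw [hN]; exact inner_self_ne_zero.mpr hχ0
  have hNr : (starRingEnd ℂ) N = N := inner_conj_symm _ _
  have hγ3 : γ = N * (starRingEnd ℂ) U := by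
    rw [← hNr, ← map_mul, ← hC, Complex.conj_conj]
  have hγ0 : (starRingEnd ℂ) γ ≠ 0 := by rw [hC]; exact mul_ne_zero hN0 hij
  set W := ⟪e χ, χ⟫_ℂ
  -- The entries `(j, j)` and `(j, i)` of the polarized identity for `e χ` and `χ` both contain the
  -- unknown `W`. It is eliminated, and the nonzero factor `γ̄ N` cancels.
  have h1 : ((t₂ * t₃ : ℝ) : ℂ) * (⟪u (some i), u (some i)⟫_ℂ * ⟪u (some j), u (some j)⟫_ℂ) =
      U * (starRingEnd ℂ) U := by
    apply mul_left_cancel₀ (mul_ne_zero hγ0 hN0)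
    linear_combination ⟪u (some j), u (some j)⟫_ℂ * hB - U * hA + (starRingEnd ℂ) γ * U * hγ3
  rw [Complex.mul_conj, inner_self_eq_norm_sq_to_K, inner_self_eq_norm_sq_to_K,
    Complex.normSq_eq_norm_sq] at h1
  exact Complex.ofReal_injective (by simpa using h1)

end Overlap

/-! ### Extracting a qubit from a pair of binary measurements -/

section Qubit

variable {H : Type*} [NormedAddCommGroup H] [InnerProductSpace ℂ H]

theorem eq_add_of_orthonormal_pair (hd : Module.finrank ℂ H = 2) {e e' : H} (he : ‖e‖ = 1)
    (he' : ‖e'‖ = 1) (h : ⟪e, e'⟫_ℂ = 0) (v : H) : ⟪e, v⟫_ℂ • e + ⟪e', v⟫_ℂ • e' = v := by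
  have ho : Orthonormal ℂ ![e, e'] := by
    rw [orthonormal_iff_ite]
    simp [Fin.forall_fin_two, he, he', h, inner_eq_zero_symm.mp h]
  have hc : Fintype.card (Fin 2) = Module.finrank ℂ H := by simp [hd]
  set b := (basisOfOrthonormalOfCardEqFinrank ho hc).toOrthonormalBasis (by simpa using ho)
  have hb : ∀ i, b i = ![e, e'] i := fun i => by simp [b]
  simpa [Fin.sum_univ_two, hb] using b.sum_repr' v

/-- The operator `|v⟩⟨v|`. -/
noncomputable def ketBra (v : H) : H →ₗ[ℂ] H := (innerₛₗ ℂ v).smulRight v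

@[simp] theorem ketBra_apply (v x : H) : ketBra v x = ⟪v, x⟫_ℂ • v := rfl

theorem isSymmetricProjection_ketBra {v : H} (hv : ‖v‖ = 1) :
    (ketBra v).IsSymmetricProjection where
  isIdempotentElem := by
    ext x
    simp [hv]
  isSymmetric x y := by simp [inner_smul_left, inner_smul_right, mul_comm]

/-- The other outcome of the same measurement. -/
def LocalIndex.flip (x : LocalIndex) : LocalIndex := (1 - x.1, x.2)

theorem LocalIndex.eq_or_eq_flip {x l : LocalIndex} (h : l.2 = x.2) : l = x ∨ l = x.flip := by
  obtain ⟨x1, x2⟩ := x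
  obtain ⟨l1, l2⟩ := l
  simp only [LocalIndex.flip, Prod.mk.injEq]
  simp only at h
  subst h
  simp only [and_true]
  revert x1 l1
  decide

theorem inner_flip {a : LocalIndex → H} (hao : ∀ s : Fin 2, ⟪a (0, s), a (1, s)⟫_ℂ = 0)
    (x : LocalIndex) : ⟪a x, a x.flip⟫_ℂ = 0 := by
  obtain ⟨x1, x2⟩ := x
  fin_cases x1
  · exact hao x2
  · exact inner_eq_zero_symm.mp (hao x2)

theorem IsBinaryMeasurementPair.apply_flip {P : LocalIndex → (H →ₗ[ℂ] H)}
    (hP : IsBinaryMeasurementPair P) (x : LocalIndex) : P x.flip = 1 - P x := by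
  obtain ⟨x1, x2⟩ := x
  have := hP.sum_eq x2
  change _ = (1 : Module.End ℂ H) at this
  fin_cases x1
  · exact eq_sub_of_add_eq' this
  · exact eq_sub_of_add_eq this

theorem isBinaryMeasurementPair_ketBra (hd : Module.finrank ℂ H = 2) {a : LocalIndex → H}
    (ha : ∀ x, ‖a x‖ = 1) (hao : ∀ s : Fin 2, ⟪a (0, s), a (1, s)⟫_ℂ = 0) :
    IsBinaryMeasurementPair (fun x => ketBra (a x)) where
  isProjection x := isSymmetricProjection_ketBra (ha x)
  sum_eq s := by
    ext v
    exact eq_add_of_orthonormal_pair hd (ha _) (ha _) (hao s) v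

/-- A property which holds for one index of each measurement and is stable under passing to the
other outcome holds for all indices. -/
theorem LocalIndex.forall_of_ne {p : LocalIndex → Prop} {x x' : LocalIndex} (hx : x.2 ≠ x'.2)
    (h : p x) (h' : p x') (hf : ∀ y, p y → p y.flip) (l : LocalIndex) : p l := by
  have : l.2 = x.2 ∨ l.2 = x'.2 := by
    revert hx
    generalize l.2 = a
    generalize x.2 = b
    generalize x'.2 = c
    revert a b c
    decide
  rcases this with h1 | h1
  · rcases LocalIndex.eq_or_eq_flip h1 with rfl | rfl
    · exact h
    · exact hf _ h
  · rcases LocalIndex.eq_or_eq_flip h1 with rfl | rfl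
    · exact h'
    · exact hf _ h'

variable {L : Type*} [NormedAddCommGroup L] [InnerProductSpace ℂ L] [FiniteDimensional ℂ L]

/-- Extraction of a qubit: on the eigenspace of the overlap operator for an eigenvalue `t`
strictly between `0` and `1`, a pair of binary measurements is unitarily equivalent to a
multiple of the pair of qubit measurements with overlap `t`. -/
theorem IsBinaryMeasurementPair.exists_isometry (hd : Module.finrank ℂ H = 2) {a : LocalIndex → H}
    (ha : ∀ x, ‖a x‖ = 1) (hao : ∀ s : Fin 2, ⟪a (0, s), a (1, s)⟫_ℂ = 0)
    {P : LocalIndex → (L →ₗ[ℂ] L)} (hP : IsBinaryMeasurementPair P) {x x' : LocalIndex}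
    (hx : x.2 ≠ x'.2) {t : ℝ} (ht : ‖⟪a x, a x'⟫_ℂ‖ ^ 2 = t) (ht0 : 0 < t) (ht1 : t < 1) :
    ∃ (k : ℕ) (V : H ⊗[ℂ] EuclideanSpace ℂ (Fin k) →ₗᵢ[ℂ] L),
      (∀ l, P l ∘ₗ V.toLinearMap = V.toLinearMap ∘ₗ (ketBra (a l)).rTensor _) ∧
      Function.Exact V.toLinearMap (overlapOperator (P x) (P x') - (t : ℂ) • (1 : Module.End ℂ L)) := by
  set p : Module.End ℂ L := P x with hp
  set q : Module.End ℂ L := P x' with hq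
  have sp : p.IsSymmetric := (hP.isProjection x).isSymmetric
  have sq : q.IsSymmetric := (hP.isProjection x').isSymmetric
  have ip : p * p = p := (hP.isProjection x).isIdempotentElem
  have iq : q * q = q := (hP.isProjection x').isIdempotentElem
  have ip' : ∀ v, p (p v) = p v := fun v => congrArg (fun F => F v) ip
  have iq' : ∀ v, q (q v) = q v := fun v => congrArg (fun F => F v) iq
  set T := overlapOperator p q with hT
  have cp : ∀ v, T (p v) = p (T v) := fun v =>
    congrArg (fun F => F v) (commute_overlapOperator_left ip iq).eq
  have cq : ∀ v, T (q v) = q (T v) := fun v =>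
    congrArg (fun F => F v) (commute_overlapOperator_right ip iq).eq
  -- This is the future multiplicity space: in the model it is the image of `a x ⊗ K`.
  set M : Submodule ℂ L := LinearMap.ker (T - (t : ℂ) • 1) ⊓ LinearMap.ker (p - 1) with hM
  have memM : ∀ v, v ∈ M ↔ T v = (t : ℂ) • v ∧ p v = v := fun v => by
    simp [hM, Submodule.mem_inf, sub_eq_zero]
  let J : EuclideanSpace ℂ (Fin (Module.finrank ℂ M)) →ₗᵢ[ℂ] L :=
    M.subtypeₗᵢ.comp (stdOrthonormalBasis ℂ M).repr.symm.toLinearIsometry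
  have hJ : ∀ v, J v ∈ M := fun v => Subtype.coe_prop _
  have hJ' : ∀ v ∈ M, ∃ z, J z = v := fun v hv =>
    ⟨(stdOrthonormalBasis ℂ M).repr ⟨v, hv⟩, by simp [J]⟩
  have JT : ∀ v, T (J v) = (t : ℂ) • J v := fun v => ((memM _).1 (hJ v)).1
  have Jp : ∀ v, p (J v) = J v := fun v => ((memM _).1 (hJ v)).2
  have Jpq : ∀ v, p (q (J v)) = (t : ℂ) • J v := fun v =>
    apply_apply_of_overlapOperator ip iq (Jp v) (JT v)
  -- the scalars
  set y := x.flip with hy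
  have hxy : ⟪a x, a y⟫_ℂ = 0 := inner_flip hao x
  have hyx : ⟪a y, a x⟫_ℂ = 0 := inner_eq_zero_symm.mp hxy
  have hxx : ⟪a x, a x⟫_ℂ = 1 := by simp [ha]
  have hyy : ⟪a y, a y⟫_ℂ = 1 := by simp [ha]
  have expand : ∀ v, ⟪a x, v⟫_ℂ • a x + ⟪a y, v⟫_ℂ • a y = v :=
    eq_add_of_orthonormal_pair hd (ha _) (ha _) hxy
  have parseval : ∀ v v' : H, ⟪v, v'⟫_ℂ =
      ⟪v, a x⟫_ℂ * ⟪a x, v'⟫_ℂ + ⟪v, a y⟫_ℂ * ⟪a y, v'⟫_ℂ := fun v v' => by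
    conv_lhs => rw [← expand v']
    simp only [inner_add_right, inner_smul_right]
    ring
  set κ := ⟪a x', a x⟫_ℂ with hκ
  set ν := ⟪a y, a x'⟫_ℂ with hν
  have hκ' : ⟪a x, a x'⟫_ℂ = (starRingEnd ℂ) κ := (inner_conj_symm _ _).symm
  have hν' : ⟪a x', a y⟫_ℂ = (starRingEnd ℂ) ν := (inner_conj_symm _ _).symm
  have hκt : κ * (starRingEnd ℂ) κ = t := by
    rw [Complex.mul_conj, Complex.normSq_eq_norm_sq, ← ht, hκ', RCLike.norm_conj]
  have hνt : ν * (starRingEnd ℂ) ν = 1 - t := by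
    have h1 := parseval (a x') (a x')
    rw [← hκ, ← hν, hκ', hν', hκt] at h1
    have h2 : ⟪a x', a x'⟫_ℂ = 1 := by simp [ha]
    linear_combination h2 - h1
  have ht0' : (t : ℂ) ≠ 0 := by exact_mod_cast ht0.ne'
  have ht1' : (1 - t : ℂ) ≠ 0 := by exact_mod_cast (sub_pos.mpr ht1).ne'
  have hκ0 : κ ≠ 0 := fun h => ht0' (by rw [← hκt, h, zero_mul])
  have hν0 : ν ≠ 0 := fun h => ht1' (by rw [← hνt, h, zero_mul])
  have hκc0 : (starRingEnd ℂ) κ ≠ 0 := (map_ne_zero _).mpr hκ0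
  have hνc0 : (starRingEnd ℂ) ν ≠ 0 := (map_ne_zero _).mpr hν0
  -- In the qubit model `|a_x'⟩⟨a_x'| - t` sends `a x` to `νκ a y`. Hence `μ (q - t)` has to send
  -- the image of `a x ⊗ z` to that of `a y ⊗ z`.
  set μ : ℂ := (ν * κ)⁻¹ with hμ
  -- the map
  let B : H →ₗ[ℂ] EuclideanSpace ℂ (Fin (Module.finrank ℂ M)) →ₗ[ℂ] L :=
    (innerₛₗ ℂ (a x)).smulRight J.toLinearMap +
      (innerₛₗ ℂ (a y)).smulRight (μ • (q ∘ₗ J.toLinearMap - (t : ℂ) • J.toLinearMap))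
  let V₀ := TensorProduct.lift B
  have hV₀ : ∀ h z, V₀ (h ⊗ₜ z) =
      ⟪a x, h⟫_ℂ • J z + ⟪a y, h⟫_ℂ • μ • (q (J z) - (t : ℂ) • J z) := fun h z => rfl
  have J1 : ∀ z z', ⟪J z, q (J z')⟫_ℂ = t * ⟪z, z'⟫_ℂ := fun z z' => by
    rw [← Jp z, sp, Jpq, inner_smul_right, J.inner_map_map]
  have J2 : ∀ z z', ⟪q (J z), J z'⟫_ℂ = t * ⟪z, z'⟫_ℂ := fun z z' => by rw [sq, J1]
  have J3 : ∀ z z', ⟪q (J z), q (J z')⟫_ℂ = t * ⟪z, z'⟫_ℂ := fun z z' => by rw [sq, iq', J1]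
  have hinner : ∀ v v', ⟪V₀ v, V₀ v'⟫_ℂ = ⟪v, v'⟫_ℂ := by
    intro v v'
    induction v using TensorProduct.induction_on with
    | zero => simp
    | add v₁ v₂ h₁ h₂ => rw [map_add, inner_add_left, inner_add_left, h₁, h₂]
    | tmul h z =>
      induction v' using TensorProduct.induction_on with
      | zero => simp
      | add v₁ v₂ h₁ h₂ => rw [map_add, inner_add_right, inner_add_right, h₁, h₂]
      | tmul h' z' =>
        rw [hV₀, hV₀, TensorProduct.inner_tmul, parseval h h']
        simp only [inner_add_left, inner_add_right, inner_sub_left, inner_sub_right,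
          inner_smul_left, inner_smul_right, J1, J2, J3, J.inner_map_map, inner_conj_symm,
          Complex.conj_ofReal]
        have hμμ : μ * (starRingEnd ℂ) μ * (t * (1 - t)) = 1 := by
          rw [hμ, map_inv₀, map_mul, ← hνt, ← hκt]
          field_simp
        linear_combination ⟪h, a y⟫_ℂ * ⟪a y, h'⟫_ℂ * ⟪z, z'⟫_ℂ * hμμ
  refine ⟨_, V₀.isometryOfInner hinner, ?_, ?_⟩
  · refine LocalIndex.forall_of_ne hx ?_ ?_ fun l hl => ?_
    · refine TensorProduct.ext' fun h z => ?_
      change p (V₀ (h ⊗ₜ z)) = V₀ ((⟪a x, h⟫_ℂ • a x) ⊗ₜ z)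
      rw [hV₀, hV₀]
      simp only [map_add, map_smul, map_sub, Jp, Jpq, inner_smul_right, hxx, hyx]
      simp
    · refine TensorProduct.ext' fun h z => ?_
      change q (V₀ (h ⊗ₜ z)) = V₀ ((⟪a x', h⟫_ℂ • a x') ⊗ₜ z)
      rw [hV₀, hV₀, parseval (a x') h]
      simp only [map_add, map_smul, map_sub, iq', inner_smul_right, ← hκ, ← hν, hκ', hν']
      have e1 : μ * (1 - t) = κ⁻¹ * (starRingEnd ℂ) ν := by
        rw [hμ, ← hνt]; field_simp
      have e2 : (starRingEnd ℂ) κ = κ⁻¹ * t := by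
        rw [← hκt]; field_simp
      have e3 : ν * μ = κ⁻¹ := by rw [hμ]; field_simp
      have e4 : κ * κ⁻¹ = 1 := mul_inv_cancel₀ hκ0
      generalize κ⁻¹ = τ at *
      match_scalars
      · linear_combination ⟪a y, h⟫_ℂ * e1 - ⟪a x, h⟫_ℂ * e4 - (κ * ⟪a x, h⟫_ℂ +
          (starRingEnd ℂ) ν * ⟪a y, h⟫_ℂ) * e3
      · rw [e2]
        linear_combination t * (κ * ⟪a x, h⟫_ℂ + (starRingEnd ℂ) ν * ⟪a y, h⟫_ℂ) * e3
    · have hk := (isBinaryMeasurementPair_ketBra hd ha hao).apply_flip l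
      rw [hk, hP.apply_flip, LinearMap.sub_comp, hl, LinearMap.rTensor_sub, LinearMap.comp_sub]
      congr 1
      exact TensorProduct.ext' fun _ _ => rfl
  · have Tker : ∀ v, (T - (t : ℂ) • 1) v = 0 ↔ T v = (t : ℂ) • v := fun v => by
      simp [sub_eq_zero]
    intro v
    rw [Tker]
    constructor
    · intro hv
      obtain ⟨ζ, hζ⟩ : ∃ ζ, ζ = v - p v := ⟨_, rfl⟩
      have pζ : p ζ = 0 := by rw [hζ, map_sub, ip', sub_self]
      have Tζ : T ζ = (t : ℂ) • ζ := by rw [hζ, map_sub, cp, hv, map_smul, smul_sub]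
      have h1 : p (q ζ) = q ζ - (1 - t : ℂ) • ζ := by
        have := Tζ
        rw [hT, overlapOperator_eq ip iq] at this
        simp only [LinearMap.add_apply, LinearMap.sub_apply, Module.End.one_apply,
          Module.End.mul_apply, pζ, map_zero] at this
        rw [sub_smul, one_smul, ← this]
        abel
      obtain ⟨z₁, hz₁⟩ := hJ' (p v) ((memM _).2 ⟨by rw [cp, hv, map_smul], ip' v⟩)
      obtain ⟨z₂, hz₂⟩ := hJ' (p (q ζ)) ((memM _).2
        ⟨by rw [cp, cq, Tζ, map_smul, map_smul], ip' _⟩)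
      -- The part `ζ` of `v` in the kernel of `p` is recovered from `p q ζ ∈ M` by `(q - t) p q ζ =
      -- t (1 - t) ζ`, which gives the coefficient of `z₂`.
      refine ⟨a x ⊗ₜ z₁ + a y ⊗ₜ ((μ * (t * (1 - t)))⁻¹ • z₂), ?_⟩
      change V₀ _ = v
      rw [map_add, hV₀, TensorProduct.tmul_smul, map_smul, hV₀, hz₁, hz₂, hxx, hyx, hxy, hyy, h1,
        map_sub, map_smul, iq']
      have hμ0 : μ ≠ 0 := inv_ne_zero (mul_ne_zero hν0 hκ0)
      have h2 : (μ * (t * (1 - t)))⁻¹ * μ * (t * (1 - t)) = 1 := by field_simp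
      trans p v + ((μ * (t * (1 - t)))⁻¹ * μ * (t * (1 - t))) • ζ
      · module
      · rw [h2, hζ]; module
    · rintro ⟨z, rfl⟩
      change T (V₀ z) = (t : ℂ) • V₀ z
      induction z using TensorProduct.induction_on with
      | zero => simp
      | add v₁ v₂ h₁ h₂ => rw [map_add, map_add, h₁, h₂, smul_add]
      | tmul h z =>
        rw [hV₀]
        simp only [map_add, map_smul, map_sub, cq, JT]
        module

end Qubit

/-! ### Joint eigenspaces and positivity of eigenvalues -/

section JointEigenspace

variable {H : Type*} [NormedAddCommGroup H] [InnerProductSpace ℂ H]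

theorem LinearMap.IsSymmetric.starProjection_apply_comm {E : Module.End ℂ H} (hE : E.IsSymmetric)
    {W : Submodule ℂ H} [W.HasOrthogonalProjection] (hW : ∀ x ∈ W, E x ∈ W) (v : H) :
    W.starProjection (E v) = E (W.starProjection v) := by
  refine Submodule.eq_starProjection_of_mem_of_inner_eq_zero
    (hW _ (W.starProjection_apply_mem v)) fun x hx => ?_
  rw [← map_sub, hE]
  exact Submodule.starProjection_inner_eq_zero v _ (hW x hx)

/-- A vector is an eigenvector of a member of a commuting family of symmetric operators as soon as
its projections to all joint eigenspaces are. -/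
theorem apply_eq_smul_of_forall_joint_eigenspace [FiniteDimensional ℂ H] {ι : Type*}
    {T : ι → Module.End ℂ H} (hT : ∀ n, (T n).IsSymmetric)
    (hc : Pairwise (Function.onFun Commute T)) {n : ι} {t : ℝ} {ψ : H}
    (h : ∀ χ : ι → ℂ, (⨅ n, Module.End.eigenspace (T n) (χ n)).starProjection ψ ≠ 0 → χ n = t) :
    T n ψ = (t : ℂ) • ψ := by
  have hsup := LinearMap.IsSymmetric.iSup_iInf_eq_top_of_commute hT hc
  set φ := T n ψ - (t : ℂ) • ψ with hφ
  -- The defect `φ` is orthogonal to each joint eigenspace: either `ψ` has no component there, or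
  -- the eigenvalue is `t`. These spaces span, so `φ = 0`.
  have hle : ∀ χ : ι → ℂ, (⨅ n, Module.End.eigenspace (T n) (χ n)) ≤ (ℂ ∙ φ)ᗮ := fun χ w hw => by
    rw [Submodule.mem_orthogonal_singleton_iff_inner_left]
    have hw' : T n w = χ n • w := Module.End.mem_eigenspace_iff.mp ((Submodule.mem_iInf _).1 hw n)
    by_cases h0 : (⨅ n, Module.End.eigenspace (T n) (χ n)).starProjection ψ = 0
    · have hz : ⟪w, ψ⟫_ℂ = 0 := by
        have := Submodule.starProjection_inner_eq_zero
          (K := ⨅ n, Module.End.eigenspace (T n) (χ n)) ψ w hw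
        rw [h0, sub_zero] at this
        exact inner_eq_zero_symm.mp this
      rw [hφ, inner_sub_right, inner_smul_right, ← hT n, hw', inner_smul_left, hz]
      simp
    · rw [hφ, inner_sub_right, inner_smul_right, ← hT n, hw', h χ h0, inner_smul_left]
      simp
  have hmem : φ ∈ (ℂ ∙ φ)ᗮ := by
    have : (⊤ : Submodule ℂ H) ≤ (ℂ ∙ φ)ᗮ := hsup ▸ iSup_le hle
    exact this trivial
  rw [Submodule.mem_orthogonal_singleton_iff_inner_left, inner_self_eq_zero, hφ, sub_eq_zero] at hmem
  exact hmem

theorem nonneg_of_overlapOperator {p q : Module.End ℂ H} (hp : p.IsSymmetricProjection)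
    (hq : q.IsSymmetricProjection) {s : ℝ} {χ : H} (hχ : χ ≠ 0)
    (h : overlapOperator p q χ = (s : ℂ) • χ) : 0 ≤ s := by
  have ip := hp.isIdempotentElem.eq
  have iq := hq.isIdempotentElem.eq
  have iq' : ∀ v, q (q v) = q v := fun v => congrArg (fun F => F v) iq
  -- In this form the operator is a sum of two positive ones.
  have h1 : overlapOperator p q = p * q * p + (1 - p) * ((1 - q) * (1 - p)) := by
    rw [overlapOperator_eq ip iq]
    simp only [mul_sub, sub_mul, mul_one, one_mul, ip, ← mul_assoc]
    abel
  have h2 : ⟪χ, overlapOperator p q χ⟫_ℂ =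
      ⟪q (p χ), q (p χ)⟫_ℂ + ⟪(χ - p χ) - q (χ - p χ), (χ - p χ) - q (χ - p χ)⟫_ℂ := by
    have e1 : ⟪q (p χ), q (p χ)⟫_ℂ = ⟪χ, p (q (p χ))⟫_ℂ := by
      rw [hq.isSymmetric, iq', hp.isSymmetric]
    have e2 : ∀ z, ⟪z - q z, z - q z⟫_ℂ = ⟪z, z - q z⟫_ℂ := fun z => by
      have : ⟪q z, z - q z⟫_ℂ = 0 := by
        rw [hq.isSymmetric, map_sub, iq', sub_self, inner_zero_right]
      rw [inner_sub_left z, this, sub_zero]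
    have e3 : ∀ z, ⟪χ - p χ, z⟫_ℂ = ⟪χ, z - p z⟫_ℂ := fun z => by
      rw [inner_sub_left, hp.isSymmetric, inner_sub_right]
    rw [e1, e2, e3, h1, ← inner_add_right]
    congr 1
  rw [h, inner_smul_right, inner_self_eq_norm_sq_to_K, inner_self_eq_norm_sq_to_K,
    inner_self_eq_norm_sq_to_K] at h2
  have h3 : s * ‖χ‖ ^ 2 = ‖q (p χ)‖ ^ 2 + ‖(χ - p χ) - q (χ - p χ)‖ ^ 2 :=
    Complex.ofReal_injective (by simpa using h2)
  have h4 : 0 < ‖χ‖ ^ 2 := by positivity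
  by_contra hs
  have := mul_neg_of_neg_of_pos (not_le.mp hs) h4
  have h5 : 0 ≤ ‖q (p χ)‖ ^ 2 + ‖(χ - p χ) - q (χ - p χ)‖ ^ 2 := by positivity
  linarith

/-- Two of the products divided by the third give `s² = a²`; the sign of `s` decides the root. -/
theorem eq_of_mul_eq_mul_of_pos {a b c s t r : ℝ} (ha : 0 < a) (hb : 0 < b) (hc : 0 < c)
    (hs : 0 ≤ s) (h1 : s * t = a * b) (h2 : s * r = a * c) (h3 : t * r = b * c) :
    s = a := by
  have h4 : s ^ 2 = a ^ 2 := by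
    have : b * c ≠ 0 := by positivity
    apply mul_right_cancel₀ this
    calc s ^ 2 * (b * c) = (s * t) * (s * r) := by rw [← h3]; ring
      _ = _ := by rw [h1, h2]; ring
  exact (sq_eq_sq₀ hs ha.le).mp h4

theorem IsBinaryMeasurementPair.commute_of_ne {P : LocalIndex → (H →ₗ[ℂ] H)}
    (hP : IsBinaryMeasurementPair P) {x x' : LocalIndex} (hx : x.2 ≠ x'.2) {e : Module.End ℂ H}
    (h : Commute e (P x)) (h' : Commute e (P x')) (l : LocalIndex) : Commute e (P l) :=
  LocalIndex.forall_of_ne (p := fun l => Commute e (P l)) hx h h'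
    (fun y hy => by
      simp only [hP.apply_flip]
      exact (Commute.one_right e).sub_right hy) l

end JointEigenspace

/-! ### A linked triple makes the state a joint eigenvector -/

section Overlaps

variable {V : Type*} [Fintype V] {G : SimpleGraph V} {w : V → ℝ}
  {H K : Type*} [NormedAddCommGroup H] [InnerProductSpace ℂ H] [FiniteDimensional ℂ H]
  [NormedAddCommGroup K] [InnerProductSpace ℂ K]

/-- The state of an optimal realization is an eigenvector of the overlap operators of all parties,
for the eigenvalues determined by a triple of linked events. -/
theorem IsUniqueThetaOptimal.overlapOperator_apply {u : Option V → K}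
    (hX : IsUniqueThetaOptimal G w (Matrix.gram ℂ u).transpose) {E : V → Module.End ℂ H}
    (hE : ∀ i, (E i).IsSymmetricProjection) (he : ∀ i j, G.Adj i j → E j ∘ₗ E i = 0)
    {P Q R : LocalIndex → (H →ₗ[ℂ] H)} (hP : IsBinaryMeasurementPair P)
    (hQ : IsBinaryMeasurementPair Q) (hR : IsBinaryMeasurementPair R)
    (hPQ : ∀ l m, Commute (P l : Module.End ℂ H) (Q m))
    (hPR : ∀ l m, Commute (P l : Module.End ℂ H) (R m))
    (hQR : ∀ l m, Commute (Q l : Module.End ℂ H) (R m)) {ev : V → TriEvent}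
    (hev : ∀ k, E k = (P (ev k).1 : Module.End ℂ H) * Q (ev k).2.1 * R (ev k).2.2)
    {x x' y y' z z' : LocalIndex} (hx : x.2 ≠ x'.2) (hy : y.2 ≠ y'.2) (hz : z.2 ≠ z'.2)
    {i j k : V} (hi : ev i = (x, y, z)) (hj : ev j = (x, y', z')) (hk : ev k = (x', y, z'))
    {tA tB tC : ℝ} (htA : 0 < tA) (htB : 0 < tB) (htC : 0 < tC)
    (hui : u (some i) ≠ 0) (huj : u (some j) ≠ 0) (huk : u (some k) ≠ 0)
    (hij : ‖⟪u (some j), u (some i)⟫_ℂ‖ ^ 2 =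
      tB * tC * (‖u (some i)‖ ^ 2 * ‖u (some j)‖ ^ 2))
    (hik : ‖⟪u (some k), u (some i)⟫_ℂ‖ ^ 2 =
      tA * tC * (‖u (some i)‖ ^ 2 * ‖u (some k)‖ ^ 2))
    (hjk : ‖⟪u (some k), u (some j)⟫_ℂ‖ ^ 2 =
      tA * tB * (‖u (some j)‖ ^ 2 * ‖u (some k)‖ ^ 2))
    {ψ : H} (hψ : DominatedBy u (orbitFamily E ψ)) :
    overlapOperator (P x) (P x') ψ = (tA : ℂ) • ψ ∧
    overlapOperator (Q y) (Q y') ψ = (tB : ℂ) • ψ ∧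
    overlapOperator (R z) (R z') ψ = (tC : ℂ) • ψ := by
  have hcomm : ∀ e : Module.End ℂ H, Commute e (P x) → Commute e (P x') → Commute e (Q y) →
      Commute e (Q y') → Commute e (R z) → Commute e (R z') → ∀ k, Commute e (E k) :=
    fun e h1 h2 h3 h4 h5 h6 k => by
      rw [hev]
      exact ((hP.commute_of_ne hx h1 h2 _).mul_right (hQ.commute_of_ne hy h3 h4 _)).mul_right
        (hR.commute_of_ne hz h5 h6 _)
  have hNi : (0 : ℝ) < ‖u (some i)‖ ^ 2 := by positivity
  have hNj : (0 : ℝ) < ‖u (some j)‖ ^ 2 := by positivity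
  have hNk : (0 : ℝ) < ‖u (some k)‖ ^ 2 := by positivity
  have ne_zero : ∀ {c : ℂ} {r : ℝ}, ‖c‖ ^ 2 = r → 0 < r → c ≠ 0 := by
    rintro c r h hr rfl
    simp at h
    exact hr.ne h
  have hij0 := ne_zero hij (by positivity)
  have hik0 := ne_zero hik (by positivity)
  have hjk0 := ne_zero hjk (by positivity)
  have pP := hP.isProjection
  have pQ := hQ.isProjection
  have pR := hR.isProjection
  have cPQ : ∀ a b c d, Commute (P a : Module.End ℂ H) (Q c) ∧ Commute (P a : Module.End ℂ H) (Q d) ∧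
      Commute (P b : Module.End ℂ H) (Q c) ∧ Commute (P b : Module.End ℂ H) (Q d) := fun a b c d =>
    ⟨hPQ _ _, hPQ _ _, hPQ _ _, hPQ _ _⟩
  have cPR : ∀ a b c d, Commute (P a : Module.End ℂ H) (R c) ∧ Commute (P a : Module.End ℂ H) (R d) ∧
      Commute (P b : Module.End ℂ H) (R c) ∧ Commute (P b : Module.End ℂ H) (R d) := fun a b c d =>
    ⟨hPR _ _, hPR _ _, hPR _ _, hPR _ _⟩
  have cQR : ∀ a b c d, Commute (Q a : Module.End ℂ H) (R c) ∧ Commute (Q a : Module.End ℂ H) (R d) ∧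
      Commute (Q b : Module.End ℂ H) (R c) ∧ Commute (Q b : Module.End ℂ H) (R d) := fun a b c d =>
    ⟨hQR _ _, hQR _ _, hQR _ _, hQR _ _⟩
  have cQP : ∀ a b c d, Commute (Q a : Module.End ℂ H) (P c) ∧ Commute (Q a : Module.End ℂ H) (P d) ∧
      Commute (Q b : Module.End ℂ H) (P c) ∧ Commute (Q b : Module.End ℂ H) (P d) := fun a b c d =>
    ⟨(hPQ _ _).symm, (hPQ _ _).symm, (hPQ _ _).symm, (hPQ _ _).symm⟩
  have cRP : ∀ a b c d, Commute (R a : Module.End ℂ H) (P c) ∧ Commute (R a : Module.End ℂ H) (P d) ∧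
      Commute (R b : Module.End ℂ H) (P c) ∧ Commute (R b : Module.End ℂ H) (P d) := fun a b c d =>
    ⟨(hPR _ _).symm, (hPR _ _).symm, (hPR _ _).symm, (hPR _ _).symm⟩
  have cRQ : ∀ a b c d, Commute (R a : Module.End ℂ H) (Q c) ∧ Commute (R a : Module.End ℂ H) (Q d) ∧
      Commute (R b : Module.End ℂ H) (Q c) ∧ Commute (R b : Module.End ℂ H) (Q d) := fun a b c d =>
    ⟨(hQR _ _).symm, (hQR _ _).symm, (hQR _ _).symm, (hQR _ _).symm⟩
  have hEi := hev i
  have hEj := hev j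
  have hEk := hev k
  rw [hi] at hEi
  rw [hj] at hEj
  rw [hk] at hEk
  -- the eigenvalues on joint eigenvectors
  have key : ∀ {χ : H} {sA sB sC : ℝ}, DominatedBy u (orbitFamily E χ) → χ ≠ 0 →
      overlapOperator (P x) (P x') χ = (sA : ℂ) • χ →
      overlapOperator (Q y) (Q y') χ = (sB : ℂ) • χ →
      overlapOperator (R z) (R z') χ = (sC : ℂ) • χ → sA = tA ∧ sB = tB ∧ sC = tC := by
    intro χ sA sB sC hχ hχ0 hA hB hC
    have hA' := hA
    have hB' := hB
    have hC' := hC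
    rw [overlapOperator_comm] at hA' hB' hC'
    -- The pairs of projections are permuted so that the shared party comes first: the first party
    -- for `(i, j)`, the second for `(i, k)`, the third for `(j, k)`.
    have e1 := hX.mul_eq_of_joint_eigenvector hE he (pP x) (pP x') (pQ y') (pQ y) (pR z') (pR z)
      (cPQ _ _ _ _) (cPR _ _ _ _) (cQR _ _ _ _)
      (fun e h1 h2 h3 h4 h5 h6 => hcomm e h1 h2 h4 h3 h6 h5) hEi hEj hχ hχ0 hA hB' hC' hij0
    have e2 := hX.mul_eq_of_joint_eigenvector hE he (pQ y) (pQ y') (pP x') (pP x) (pR z') (pR z)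
      (cQP _ _ _ _) (cQR _ _ _ _) (cPR _ _ _ _)
      (fun e h1 h2 h3 h4 h5 h6 => hcomm e h4 h3 h1 h2 h6 h5)
      (hEi.trans (by rw [(hPQ x y).eq])) (hEk.trans (by rw [(hPQ x' y).eq])) hχ hχ0 hB hA' hC' hik0
    have e3 := hX.mul_eq_of_joint_eigenvector hE he (pR z') (pR z) (pP x') (pP x) (pQ y) (pQ y')
      (cRP _ _ _ _) (cRQ _ _ _ _) (cPQ _ _ _ _)
      (fun e h1 h2 h3 h4 h5 h6 => hcomm e h4 h3 h5 h6 h2 h1)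
      (hEj.trans (by rw [mul_assoc (R z'), ((hPR x z').mul_left (hQR y' z')).eq]))
      (hEk.trans (by rw [mul_assoc (R z'), ((hPR x' z').mul_left (hQR y z')).eq]))
      hχ hχ0 hC' hA' hB hjk0
    have f1 : sB * sC = tB * tC := mul_right_cancel₀ (by positivity) (e1.trans hij)
    have f2 : sA * sC = tA * tC := mul_right_cancel₀ (by positivity) (e2.trans hik)
    have f3 : sA * sB = tA * tB := mul_right_cancel₀ (by positivity) (e3.trans hjk)
    have gA := nonneg_of_overlapOperator (pP x) (pP x') hχ0 hA
    have gB := nonneg_of_overlapOperator (pQ y) (pQ y') hχ0 hB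
    have gC := nonneg_of_overlapOperator (pR z) (pR z') hχ0 hC
    exact ⟨eq_of_mul_eq_mul_of_pos htA htB htC gA f3 f2 f1,
      eq_of_mul_eq_mul_of_pos htB htA htC gB (by linarith) f1 f2,
      eq_of_mul_eq_mul_of_pos htC htA htB gC (by linarith) (by linarith) f3⟩
  -- decomposition into joint eigenvectors
  set T : Fin 3 → Module.End ℂ H := ![overlapOperator (P x) (P x'), overlapOperator (Q y) (Q y'),
    overlapOperator (R z) (R z')] with hT
  have symT : ∀ n, (T n).IsSymmetric := by
    intro n
    fin_cases n
    · exact isSymmetric_overlapOperator (pP x).isSymmetric (pP x').isSymmetric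
    · exact isSymmetric_overlapOperator (pQ y).isSymmetric (pQ y').isSymmetric
    · exact isSymmetric_overlapOperator (pR z).isSymmetric (pR z').isSymmetric
  have cT : ∀ n, ∀ e : Module.End ℂ H, (∀ l, Commute e (P l)) → (∀ l, Commute e (Q l)) →
      (∀ l, Commute e (R l)) → Commute e (T n) := by
    intro n e h1 h2 h3
    fin_cases n
    · exact Commute.overlapOperator (h1 _) (h1 _)
    · exact Commute.overlapOperator (h2 _) (h2 _)
    · exact Commute.overlapOperator (h3 _) (h3 _)
  have iP : ∀ l, (P l : Module.End ℂ H) * P l = P l := fun l => (pP l).isIdempotentElem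
  have iQ : ∀ l, (Q l : Module.End ℂ H) * Q l = Q l := fun l => (pQ l).isIdempotentElem
  have iR : ∀ l, (R l : Module.End ℂ H) * R l = R l := fun l => (pR l).isIdempotentElem
  have TP : ∀ n l, Commute (T n) (P l) := by
    intro n
    fin_cases n
    · exact hP.commute_of_ne hx (commute_overlapOperator_left (iP x) (iP x'))
        (commute_overlapOperator_right (iP x) (iP x'))
    · exact fun l => (Commute.overlapOperator (hPQ _ _) (hPQ _ _)).symm
    · exact fun l => (Commute.overlapOperator (hPR _ _) (hPR _ _)).symm
  have TQ : ∀ n l, Commute (T n) (Q l) := by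
    intro n
    fin_cases n
    · exact fun l => (Commute.overlapOperator (hPQ _ _).symm (hPQ _ _).symm).symm
    · exact hQ.commute_of_ne hy (commute_overlapOperator_left (iQ y) (iQ y'))
        (commute_overlapOperator_right (iQ y) (iQ y'))
    · exact fun l => (Commute.overlapOperator (hQR _ _) (hQR _ _)).symm
  have TR : ∀ n l, Commute (T n) (R l) := by
    intro n
    fin_cases n
    · exact fun l => (Commute.overlapOperator (hPR _ _).symm (hPR _ _).symm).symm
    · exact fun l => (Commute.overlapOperator (hQR _ _).symm (hQR _ _).symm).symm
    · exact hR.commute_of_ne hz (commute_overlapOperator_left (iR z) (iR z'))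
        (commute_overlapOperator_right (iR z) (iR z'))
  have TE : ∀ n m, Commute (T n) (E m) := fun n m => by
    rw [hev]
    exact ((TP n _).mul_right (TQ n _)).mul_right (TR n _)
  have TT : Pairwise (Function.onFun Commute T) := fun n m _ => cT m _ (TP n) (TQ n) (TR n)
  have main : ∀ χ : Fin 3 → ℂ, (⨅ n, Module.End.eigenspace (T n) (χ n)).starProjection ψ ≠ 0 →
      χ 0 = tA ∧ χ 1 = tB ∧ χ 2 = tC := by
    intro χ h0
    set W := ⨅ n, Module.End.eigenspace (T n) (χ n) with hW
    have memW : ∀ v, v ∈ W ↔ ∀ n, T n v = χ n • v := fun v => by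
      simp [hW, Submodule.mem_iInf]
    have hv := (memW _).1 (W.starProjection_apply_mem ψ)
    have hreal : ∀ n, χ n = ((χ n).re : ℂ) := fun n =>
      (Complex.conj_eq_iff_re.mp ((symT n).conj_eigenvalue_eq_self
        (Module.End.hasEigenvalue_of_hasEigenvector
          ⟨Module.End.mem_eigenspace_iff.mpr (hv n), h0⟩))).symm
    -- The joint eigenspace is invariant under the symmetric operators `E m`, so its orthogonal
    -- projection commutes with them and keeps the orbit dominated.
    have hdom : DominatedBy u (orbitFamily E (W.starProjection ψ)) :=
      hψ.orbitFamily_map W.starProjection fun m =>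
        (hE m).isSymmetric.starProjection_apply_comm (fun v hv => (memW _).2 fun n => by
          rw [← Module.End.mul_apply, (TE n m).eq, Module.End.mul_apply, (memW v).1 hv n,
            map_smul]) ψ
    have h1 := hv 0
    have h2 := hv 1
    have h3 := hv 2
    rw [hreal 0] at h1
    rw [hreal 1] at h2
    rw [hreal 2] at h3
    obtain ⟨k1, k2, k3⟩ := key hdom h0 h1 h2 h3
    rw [hreal 0, hreal 1, hreal 2, k1, k2, k3]
    exact ⟨rfl, rfl, rfl⟩
  exact ⟨apply_eq_smul_of_forall_joint_eigenspace (n := 0) symT TT fun χ h => (main χ h).1,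
    apply_eq_smul_of_forall_joint_eigenspace (n := 1) symT TT fun χ h => (main χ h).2.1,
    apply_eq_smul_of_forall_joint_eigenspace (n := 2) symT TT fun χ h => (main χ h).2.2⟩

end Overlaps

/-! ### Local operators on a tripartite tensor product -/

section TensorOperators

variable {H K : Type*} [NormedAddCommGroup H] [InnerProductSpace ℂ H]
  [NormedAddCommGroup K] [InnerProductSpace ℂ K]

theorem LinearMap.IsSymmetric.tensorMap {f : H →ₗ[ℂ] H} {g : K →ₗ[ℂ] K} (hf : f.IsSymmetric)
    (hg : g.IsSymmetric) : (TensorProduct.map f g).IsSymmetric := by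
  intro v v'
  induction v using TensorProduct.induction_on with
  | zero => simp
  | add v₁ v₂ h₁ h₂ => rw [map_add, inner_add_left, inner_add_left, h₁, h₂]
  | tmul h z =>
    induction v' using TensorProduct.induction_on with
    | zero => simp
    | add v₁ v₂ h₁ h₂ => rw [map_add, inner_add_right, inner_add_right, h₁, h₂]
    | tmul h' z' =>
      simp only [TensorProduct.map_tmul, TensorProduct.inner_tmul, hf h h', hg z z']

theorem LinearMap.IsSymmetricProjection.tensorMap {f : H →ₗ[ℂ] H} {g : K →ₗ[ℂ] K}
    (hf : f.IsSymmetricProjection) (hg : g.IsSymmetricProjection) :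
    (TensorProduct.map f g).IsSymmetricProjection where
  isIdempotentElem := by
    have h1 := hf.isIdempotentElem
    have h2 := hg.isIdempotentElem
    rw [IsIdempotentElem, Module.End.mul_eq_comp] at *
    rw [← TensorProduct.map_comp, h1, h2]
  isSymmetric := hf.isSymmetric.tensorMap hg.isSymmetric

end TensorOperators

/-- The operators on a Hilbert space. -/
abbrev Operators (H : Type*) [NormedAddCommGroup H] [InnerProductSpace ℂ H] : Type _ :=
  Module.End ℂ H

section Tripartite

variable {HA HB HC : Type*}
  [NormedAddCommGroup HA] [InnerProductSpace ℂ HA]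
  [NormedAddCommGroup HB] [InnerProductSpace ℂ HB]
  [NormedAddCommGroup HC] [InnerProductSpace ℂ HC]

variable (HA HB HC) in
/-- Operators of the first party, acting on the tensor product. -/
noncomputable def actA : Module.End ℂ HA →ₐ[ℂ] Operators (HA ⊗[ℂ] (HB ⊗[ℂ] HC)) :=
  Module.End.rTensorAlgHom ℂ HA (HB ⊗[ℂ] HC)

variable (HA HB HC) in
/-- Operators of the second party, acting on the tensor product. -/
noncomputable def actB : Module.End ℂ HB →ₐ[ℂ] Operators (HA ⊗[ℂ] (HB ⊗[ℂ] HC)) :=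
  (Module.End.lTensorAlgHom ℂ (HB ⊗[ℂ] HC) HA).comp (Module.End.rTensorAlgHom ℂ HB HC)

variable (HA HB HC) in
/-- Operators of the third party, acting on the tensor product. -/
noncomputable def actC : Module.End ℂ HC →ₐ[ℂ] Operators (HA ⊗[ℂ] (HB ⊗[ℂ] HC)) :=
  (Module.End.lTensorAlgHom ℂ (HB ⊗[ℂ] HC) HA).comp (Module.End.lTensorAlgHom ℂ HC HB)

theorem commute_actA_actB (f : Module.End ℂ HA) (g : Module.End ℂ HB) :
    Commute (actA HA HB HC f) (actB HA HB HC g) :=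
  TensorProduct.ext_threefold' fun _ _ _ => rfl

theorem commute_actA_actC (f : Module.End ℂ HA) (g : Module.End ℂ HC) :
    Commute (actA HA HB HC f) (actC HA HB HC g) :=
  TensorProduct.ext_threefold' fun _ _ _ => rfl

theorem commute_actB_actC (f : Module.End ℂ HB) (g : Module.End ℂ HC) :
    Commute (actB HA HB HC f) (actC HA HB HC g) :=
  TensorProduct.ext_threefold' fun _ _ _ => rfl

theorem productOperator_eq {ιA ιB ιC : Type*} (P : ιA → (HA →ₗ[ℂ] HA)) (Q : ιB → (HB →ₗ[ℂ] HB))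
    (R : ιC → (HC →ₗ[ℂ] HC)) (i : ιA × ιB × ιC) :
    productOperator P Q R i =
      actA HA HB HC (P i.1) * actB HA HB HC (Q i.2.1) * actC HA HB HC (R i.2.2) :=
  TensorProduct.ext_threefold' fun _ _ _ => rfl

theorem IsBinaryMeasurementPair.map_algHom {H : Type*} [NormedAddCommGroup H]
    [InnerProductSpace ℂ H] {P : LocalIndex → (HA →ₗ[ℂ] HA)} (hP : IsBinaryMeasurementPair P)
    (φ : Module.End ℂ HA →ₐ[ℂ] Module.End ℂ H)
    (hφ : ∀ f : Module.End ℂ HA, f.IsSymmetric → (φ f).IsSymmetric) :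
    IsBinaryMeasurementPair (fun l => φ (P l)) where
  isProjection x := ⟨(hP.isProjection x).isIdempotentElem.map φ,
    hφ _ (hP.isProjection x).isSymmetric⟩
  sum_eq s := by
    have : P (0, s) + P (1, s) = (1 : Module.End ℂ HA) := hP.sum_eq s
    rw [← map_add, this, map_one]
    rfl

theorem isSymmetric_actA {f : Module.End ℂ HA} (hf : f.IsSymmetric) :
    LinearMap.IsSymmetric (𝕜 := ℂ) (E := HA ⊗[ℂ] (HB ⊗[ℂ] HC)) (actA HA HB HC f) := hf.tensorMap fun _ _ => rfl

theorem isSymmetric_actB {f : Module.End ℂ HB} (hf : f.IsSymmetric) :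
    LinearMap.IsSymmetric (𝕜 := ℂ) (E := HA ⊗[ℂ] (HB ⊗[ℂ] HC)) (actB HA HB HC f) :=
  LinearMap.IsSymmetric.tensorMap (fun _ _ => rfl) (hf.tensorMap fun _ _ => rfl)

theorem isSymmetric_actC {f : Module.End ℂ HC} (hf : f.IsSymmetric) :
    LinearMap.IsSymmetric (𝕜 := ℂ) (E := HA ⊗[ℂ] (HB ⊗[ℂ] HC)) (actC HA HB HC f) :=
  LinearMap.IsSymmetric.tensorMap (fun _ _ => rfl)
    (LinearMap.IsSymmetric.tensorMap (fun _ _ => rfl) hf)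

theorem overlapOperator_map {H : Type*} [NormedAddCommGroup H] [InnerProductSpace ℂ H]
    (φ : Module.End ℂ HA →ₐ[ℂ] Module.End ℂ H) (p q : Module.End ℂ HA) :
    overlapOperator (φ p) (φ q) = φ (overlapOperator p q) := by
  simp [overlapOperator]

variable {P : LocalIndex → (HA →ₗ[ℂ] HA)} {Q : LocalIndex → (HB →ₗ[ℂ] HB)}
  {R : LocalIndex → (HC →ₗ[ℂ] HC)}

theorem isSymmetricProjection_productOperator (hP : IsBinaryMeasurementPair P)
    (hQ : IsBinaryMeasurementPair Q) (hR : IsBinaryMeasurementPair R) (i : TriEvent) :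
    LinearMap.IsSymmetricProjection (𝕜 := ℂ) (E := HA ⊗[ℂ] (HB ⊗[ℂ] HC))
      (productOperator P Q R i) :=
  (hP.isProjection _).tensorMap ((hQ.isProjection _).tensorMap (hR.isProjection _))

theorem IsBinaryMeasurementPair.comp_eq_zero (hP : IsBinaryMeasurementPair P) {x y : LocalIndex}
    (h : LocallyExclusive x y) : P y ∘ₗ P x = 0 := by
  rcases LocalIndex.eq_or_eq_flip h.1.symm with rfl | rfl
  · exact absurd rfl h.2
  · have := (hP.isProjection x).isIdempotentElem.eq
    rw [hP.apply_flip, ← Module.End.mul_eq_comp, sub_mul, one_mul, this, sub_self]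

theorem productOperator_comp_eq_zero (hP : IsBinaryMeasurementPair P)
    (hQ : IsBinaryMeasurementPair Q) (hR : IsBinaryMeasurementPair R) {I : Finset TriEvent} (i j : I)
    (h : (exclusivityGraph I).Adj i j) :
    productOperator P Q R j.1 ∘ₗ productOperator P Q R i.1 = 0 := by
  rw [productOperator, productOperator, ← TensorProduct.map_comp, ← TensorProduct.map_comp]
  rcases h with h | h | h
  · rw [hP.comp_eq_zero h, TensorProduct.map_zero_left]
  · rw [hQ.comp_eq_zero h, TensorProduct.map_zero_left, TensorProduct.map_zero_right]
  · rw [hR.comp_eq_zero h, TensorProduct.map_zero_right, TensorProduct.map_zero_right]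

end Tripartite

/-! ### Gram matrices of the two systems -/

section Matrices

variable {V : Type*} {H K : Type*} [NormedAddCommGroup H] [InnerProductSpace ℂ H]
  [NormedAddCommGroup K] [InnerProductSpace ℂ K]

/-- The vectors `η_i v_i` together with `ψ`. -/
noncomputable def weightedFamily (ψ : H) (η : V → ℝ) (v : V → H) : Option V → H :=
  fun i => (withOne η i : ℂ) • withState ψ v i

theorem referenceMatrix_eq_gram (ψ : H) (η : V → ℝ) (v : V → H) :
    referenceMatrix ψ η v = (Matrix.gram ℂ (weightedFamily ψ η v)).transpose := by
  ext i j
  simp only [referenceMatrix, Matrix.of_apply, Matrix.transpose_apply, Matrix.gram_apply,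
    weightedFamily, inner_smul_left, inner_smul_right, Complex.conj_ofReal]
  ring

theorem realizationMatrix_eq_gram (ψ : H) {E : V → (H →ₗ[ℂ] H)} (hE : ∀ i, (E i).IsSymmetric) :
    realizationMatrix ψ E = (Matrix.gram ℂ (orbitFamily E ψ)).transpose := by
  ext i j
  simp only [realizationMatrix, Matrix.of_apply, Matrix.transpose_apply, Matrix.gram_apply,
    orbitFamily]
  cases j with
  | none => rfl
  | some j => exact (hE j _ _).symm

theorem DominatedBy.of_gram_eq {ι : Type*} [Fintype ι] {u : ι → K} {g : ι → H}
    (h : Matrix.gram ℂ g = Matrix.gram ℂ u) : DominatedBy u g := by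
  refine ⟨1, fun d => ?_⟩
  have h1 := Matrix.star_dotProduct_gram_mulVec g d d
  rw [h, Matrix.star_dotProduct_gram_mulVec, inner_self_eq_norm_sq_to_K,
    inner_self_eq_norm_sq_to_K] at h1
  have h2 : ‖∑ i, d i • u i‖ ^ 2 = ‖∑ i, d i • g i‖ ^ 2 :=
    Complex.ofReal_injective (by simpa using h1)
  rw [one_mul, h2]

end Matrices

/-! ### Rigidity of the reference system -/

section Reference

variable {H : Type*} [NormedAddCommGroup H] [InnerProductSpace ℂ H]

theorem ketBra_smul {z : ℂ} (hz : ‖z‖ = 1) (v : H) : ketBra (z • v) = ketBra v := by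
  ext x
  have : (starRingEnd ℂ) z * z = 1 := by
    rw [mul_comm, Complex.mul_conj, Complex.normSq_eq_norm_sq, hz]; simp
  simp only [ketBra_apply, inner_smul_left, smul_smul]
  congr 1
  linear_combination ⟪v, x⟫_ℂ * this

theorem ketBra_eq_of_norm_inner {v v' : H} (hv : ‖v‖ = 1) (hv' : ‖v'‖ = 1)
    (h : ‖⟪v, v'⟫_ℂ‖ = 1) : ketBra v' = ketBra v := by
  obtain ⟨r, -, hr⟩ := (norm_inner_eq_norm_iff (𝕜 := ℂ) (x := v) (y := v')
    (by rintro rfl; simp at hv) (by rintro rfl; simp at hv')).1 (by rw [h, hv, hv', mul_one])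
  rw [hr]
  refine ketBra_smul ?_ v
  rw [hr, norm_smul, hv, mul_one] at hv'
  exact hv'

theorem ketBra_ne_smul_one {v v' : H} (hv : ‖v‖ = 1) (hv' : ‖v'‖ = 1) (h : ⟪v, v'⟫_ℂ = 0) (z : ℂ) :
    ketBra v ≠ z • (1 : Module.End ℂ H) := fun hz => by
  have h1 := congrArg (fun F => ⟪v', F v'⟫_ℂ) hz
  have h2 := congrArg (fun F => ⟪v, F v⟫_ℂ) hz
  simp [h, hv'] at h1
  simp [hv, ← h1] at h2

variable {HA HB HC : Type*}
  [NormedAddCommGroup HA] [InnerProductSpace ℂ HA]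
  [NormedAddCommGroup HB] [InnerProductSpace ℂ HB]
  [NormedAddCommGroup HC] [InnerProductSpace ℂ HC]

theorem ketBra_tmul (v : HA) (v' : HB) :
    ketBra (v ⊗ₜ[ℂ] v') = TensorProduct.map (ketBra v) (ketBra v') := by
  refine TensorProduct.ext' fun x y => ?_
  simp [TensorProduct.tmul_smul, TensorProduct.smul_tmul', smul_smul, mul_comm]

theorem ketBra_eventVector {I : Finset TriEvent} {θ : I → ℂ} (hθ : ∀ i, ‖θ i‖ = 1)
    (a : LocalIndex → HA) (b : LocalIndex → HB) (c : LocalIndex → HC) (i : I) :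
    ketBra (eventVector θ a b c i) =
      productOperator (fun x => ketBra (a x)) (fun x => ketBra (b x)) (fun x => ketBra (c x)) i.1 := by
  rw [eventVector, ketBra_smul (hθ i), productVector, ketBra_tmul, ketBra_tmul, productOperator]

theorem eq_zero_of_inner_span {ι : Type*} {v : ι → H} (hspan : Submodule.span ℂ (Set.range v) = ⊤)
    {ξ : H} (h : ∀ i, ⟪v i, ξ⟫_ℂ = 0) : ξ = 0 := by
  have hle : Submodule.span ℂ (Set.range v) ≤ (ℂ ∙ ξ)ᗮ := by
    rw [Submodule.span_le]
    rintro _ ⟨i, rfl⟩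
    exact Submodule.mem_orthogonal_singleton_iff_inner_left.mpr (h i)
  rw [hspan] at hle
  exact inner_self_eq_zero.mp
    (Submodule.mem_orthogonal_singleton_iff_inner_left.mp (hle (Submodule.mem_top (x := ξ))))

variable {V : Type*} [Fintype V] {G : SimpleGraph V} {w : V → ℝ}
  {ψ : H} {η : V → ℝ} {v : V → H}

/-- The diagonal constraint reads `η_i² = η_i ⟪v_i, ψ⟫`. -/
theorem IsUniqueThetaOptimal.inner_state
    (hX : IsUniqueThetaOptimal G w (Matrix.gram ℂ (weightedFamily ψ η v)).transpose)
    (hη : ∀ i, 0 < η i) (hv : ∀ i, ‖v i‖ = 1) (i : V) : ⟪v i, ψ⟫_ℂ = η i := by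
  have h := hX.1.1.diag i
  simp only [Matrix.transpose_apply, Matrix.gram_apply, weightedFamily, withOne, withState,
    inner_smul_left, inner_smul_right, Complex.conj_ofReal, Complex.ofReal_one, one_mul,
    inner_self_eq_norm_sq_to_K] at h
  have h0 : (η i : ℂ) ≠ 0 := by exact_mod_cast (hη i).ne'
  apply mul_left_cancel₀ h0
  rw [← h, norm_smul, hv, mul_one]
  simp [sq, abs_of_pos (hη i)]

/-- The reference family is itself an orbit of rank-one projections, so the polarized identity
applies inside the reference system. -/
theorem IsUniqueThetaOptimal.orbitFamily_ketBra
    (hX : IsUniqueThetaOptimal G w (Matrix.gram ℂ (weightedFamily ψ η v)).transpose)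
    (hη : ∀ i, 0 < η i) (hv : ∀ i, ‖v i‖ = 1) :
    orbitFamily (fun i => ketBra (v i)) ψ = weightedFamily ψ η v := by
  funext i
  cases i with
  | none => simp [weightedFamily, withOne, withState]
  | some i => simp [weightedFamily, withOne, withState, hX.inner_state hη hv i]

/-- A vector whose orbit is dominated by the unique optimum is a multiple of the reference
state. -/
theorem IsUniqueThetaOptimal.eq_smul_state
    (hX : IsUniqueThetaOptimal G w (Matrix.gram ℂ (weightedFamily ψ η v)).transpose)
    (hη : ∀ i, 0 < η i) (hv : ∀ i, ‖v i‖ = 1)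
    (he : ∀ i j, G.Adj i j → ketBra (v j) ∘ₗ ketBra (v i) = 0)
    (hspan : Submodule.span ℂ (Set.range (withState ψ v)) = ⊤) {χ : H}
    (hχ : DominatedBy (weightedFamily ψ η v) (orbitFamily (fun i => ketBra (v i)) χ)) :
    χ = ⟪ψ, χ⟫_ℂ • ψ := by
  have horb := hX.orbitFamily_ketBra hη hv
  rw [← sub_eq_zero]
  refine eq_zero_of_inner_span hspan fun i => ?_
  -- The column of index `none` gives `⟪u i, χ⟫ = ⟪ψ, χ⟫ ⟪u i, ψ⟫`, which is the required
  -- orthogonality up to the factor `η_i`.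
  have h := hX.inner_orbitFamily (E := fun i => ketBra (v i))
    (fun i => isSymmetricProjection_ketBra (hv i)) he (χ := ψ)
    (by rw [horb]; exact .of_gram_eq rfl) hχ i none
  rw [horb] at h
  have hz : (withOne η i : ℂ) ≠ 0 := by
    cases i with
    | none => simp [withOne]
    | some i => simpa [withOne] using (hη i).ne'
  simp only [weightedFamily, orbitFamily_none, inner_smul_left, Complex.conj_ofReal] at h
  apply mul_left_cancel₀ hz
  rw [inner_sub_right, inner_smul_right, mul_sub, h]
  simp [withOne, withState]
  ring

/-- An operator commuting with all reference projections is a scalar. -/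
theorem IsUniqueThetaOptimal.eq_smul_one_of_commute [FiniteDimensional ℂ H]
    (hX : IsUniqueThetaOptimal G w (Matrix.gram ℂ (weightedFamily ψ η v)).transpose)
    (hη : ∀ i, 0 < η i) (hv : ∀ i, ‖v i‖ = 1)
    (he : ∀ i j, G.Adj i j → ketBra (v j) ∘ₗ ketBra (v i) = 0)
    (hspan : Submodule.span ℂ (Set.range (withState ψ v)) = ⊤) {D : Module.End ℂ H}
    (hD : ∀ i, Commute D (ketBra (v i))) : ∃ z : ℂ, D = z • (1 : Module.End ℂ H) := by
  have horb := hX.orbitFamily_ketBra hη hv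
  have hψ : DominatedBy (weightedFamily ψ η v) (orbitFamily (fun i => ketBra (v i)) (D ψ)) :=
    DominatedBy.orbitFamily_map (E := fun i => ketBra (v i)) (χ := ψ)
      (by rw [horb]; exact .of_gram_eq rfl) (LinearMap.toContinuousLinearMap D)
      fun i => congrArg (fun F => F ψ) (hD i).eq
  have h0 := hX.eq_smul_state hη hv he hspan hψ
  refine ⟨⟪ψ, D ψ⟫_ℂ, LinearMap.ext_on_range hspan fun i => ?_⟩
  cases i with
  | none => exact h0
  | some i =>
    -- As `η_i v_i` is the projection of `ψ`, the eigenvalue of `D` at `ψ` is inherited by `v_i`.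
    have h1 : D (ketBra (v i) ψ) = ketBra (v i) (D ψ) := congrArg (fun F => F ψ) (hD i).eq
    rw [h0, map_smul, ketBra_apply, map_smul, hX.inner_state hη hv, smul_comm] at h1
    have hz : (η i : ℂ) ≠ 0 := by exact_mod_cast (hη i).ne'
    exact smul_right_injective H hz h1

/-- If the overlap were one, the two bases would coincide up to phases. Then `|a_x⟩⟨a_x|` would
commute with every reference projection and be a scalar, although it annihilates the other basis
vector. The embedding `φ` lets one argument serve all three parties. -/
theorem norm_inner_sq_lt_one [FiniteDimensional ℂ H]
    (hX : IsUniqueThetaOptimal G w (Matrix.gram ℂ (weightedFamily ψ η v)).transpose)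
    (hη : ∀ i, 0 < η i) (hv : ∀ i, ‖v i‖ = 1)
    (he : ∀ i j, G.Adj i j → ketBra (v j) ∘ₗ ketBra (v i) = 0)
    (hspan : Submodule.span ℂ (Set.range (withState ψ v)) = ⊤)
    (hdA : Module.finrank ℂ HA = 2) {a : LocalIndex → HA} (ha : ∀ x, ‖a x‖ = 1)
    (hao : ∀ s : Fin 2, ⟪a (0, s), a (1, s)⟫_ℂ = 0)
    (φ : Module.End ℂ HA →ₐ[ℂ] Module.End ℂ H) (hφ : Function.Injective φ)
    (hcomm : ∀ f : Module.End ℂ HA, (∀ l, Commute f (ketBra (a l))) →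
      ∀ i, Commute (φ f) (ketBra (v i)))
    {x x' : LocalIndex} (hx : x.2 ≠ x'.2) : ‖⟪a x, a x'⟫_ℂ‖ ^ 2 < 1 := by
  have hle : ‖⟪a x, a x'⟫_ℂ‖ ≤ 1 := (norm_inner_le_norm _ _).trans (by simp [ha])
  refine lt_of_le_of_ne (pow_le_one₀ (norm_nonneg _) hle) fun h1 => ?_
  have h2 : ‖⟪a x, a x'⟫_ℂ‖ = 1 := (pow_eq_one_iff_of_nonneg (norm_nonneg _) two_ne_zero).mp h1
  have hb := isBinaryMeasurementPair_ketBra hdA ha hao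
  obtain ⟨z, hz⟩ := hX.eq_smul_one_of_commute hη hv he hspan
    (hcomm (ketBra (a x)) (hb.commute_of_ne hx (Commute.refl _)
      (by simp only [ketBra_eq_of_norm_inner (ha x) (ha x') h2]; exact Commute.refl _)))
  refine ketBra_ne_smul_one (ha x) (ha x.flip) (inner_flip hao x) z (hφ ?_)
  rw [hz, map_smul, map_one]

end Reference

/-! ### Slices of a tensor and products of isometries -/

section Slices

variable {H K : Type*} [NormedAddCommGroup H] [InnerProductSpace ℂ H]
  [NormedAddCommGroup K] [InnerProductSpace ℂ K]

variable (H) in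
/-- Contraction of the second tensor factor with `k`. -/
noncomputable def sliceMap (k : K) : H ⊗[ℂ] K →ₗ[ℂ] H :=
  (TensorProduct.rid ℂ H).toLinearMap ∘ₗ (innerₛₗ ℂ k).lTensor H

theorem sliceMap_tmul (k : K) (h : H) (k' : K) : sliceMap H k (h ⊗ₜ k') = ⟪k, k'⟫_ℂ • h := by
  simp [sliceMap]

theorem sliceMap_rTensor (k : K) (f : H →ₗ[ℂ] H) (Ψ : H ⊗[ℂ] K) :
    sliceMap H k (f.rTensor K Ψ) = f (sliceMap H k Ψ) := by
  have : sliceMap H k ∘ₗ f.rTensor K = f ∘ₗ sliceMap H k :=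
    TensorProduct.ext' fun h k' => by simp [sliceMap_tmul]
  exact congrArg (fun F => F Ψ) this

theorem inner_tmul_left_eq (h : H) (k : K) (Ψ : H ⊗[ℂ] K) :
    ⟪h ⊗ₜ[ℂ] k, Ψ⟫_ℂ = ⟪h, sliceMap H k Ψ⟫_ℂ := by
  induction Ψ using TensorProduct.induction_on with
  | zero => simp
  | add v₁ v₂ h₁ h₂ => rw [map_add, inner_add_right, inner_add_right, h₁, h₂]
  | tmul h' k' => rw [sliceMap_tmul, TensorProduct.inner_tmul, inner_smul_right, mul_comm]

/-- The second factor is the contraction of `Ψ` with `ψ`. Both sides then have the same inner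
products with pure tensors. -/
theorem exists_eq_tmul_of_sliceMap {ψ : H} {Ψ : H ⊗[ℂ] K}
    (h : ∀ k, sliceMap H k Ψ = ⟪ψ, sliceMap H k Ψ⟫_ℂ • ψ) : ∃ J : K, Ψ = ψ ⊗ₜ[ℂ] J := by
  refine ⟨TensorProduct.lid ℂ K ((innerₛₗ ℂ ψ).rTensor K Ψ), ?_⟩
  have hJ : ∀ k : K, ⟪k, TensorProduct.lid ℂ K ((innerₛₗ ℂ ψ).rTensor K Ψ)⟫_ℂ =
      ⟪ψ ⊗ₜ[ℂ] k, Ψ⟫_ℂ := fun k => by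
    clear h
    induction Ψ using TensorProduct.induction_on with
    | zero => simp
    | add v₁ v₂ h₁ h₂ => rw [map_add, map_add, inner_add_right, inner_add_right, h₁, h₂]
    | tmul h' k' => simp
  rw [TensorProduct.ext_iff_inner_left]
  intro x k
  have h1 := congrArg (fun v => ⟪x, v⟫_ℂ) (h k)
  simp only [inner_smul_right] at h1
  rw [TensorProduct.inner_tmul, hJ, inner_tmul_left_eq, inner_tmul_left_eq, h1, mul_comm]

end Slices

section ProductIsometries

variable {H K L : Type*} [NormedAddCommGroup H] [InnerProductSpace ℂ H]
  [NormedAddCommGroup K] [InnerProductSpace ℂ K] [NormedAddCommGroup L] [InnerProductSpace ℂ L]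

/-- A linear map on a tensor product which preserves inner products of pure tensors. -/
def PreservesInner (W : H ⊗[ℂ] K →ₗ[ℂ] L) : Prop :=
  ∀ h h' k k', ⟪W (h ⊗ₜ k), W (h' ⊗ₜ k')⟫_ℂ = ⟪h, h'⟫_ℂ * ⟪k, k'⟫_ℂ

theorem LinearIsometry.preservesInner (W : H ⊗[ℂ] K →ₗᵢ[ℂ] L) : PreservesInner W.toLinearMap :=
  fun h h' k k' => by
    rw [LinearIsometry.coe_toLinearMap, LinearIsometry.inner_map_map, TensorProduct.inner_tmul]

theorem PreservesInner.inner_map {W : H ⊗[ℂ] K →ₗ[ℂ] L} (hW : PreservesInner W)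
    (x y : H ⊗[ℂ] K) : ⟪W x, W y⟫_ℂ = ⟪x, y⟫_ℂ := by
  induction x using TensorProduct.induction_on with
  | zero => simp
  | add v₁ v₂ h₁ h₂ => rw [map_add, inner_add_left, inner_add_left, h₁, h₂]
  | tmul h k =>
    induction y using TensorProduct.induction_on with
    | zero => simp
    | add v₁ v₂ h₁ h₂ => rw [map_add, inner_add_right, inner_add_right, h₁, h₂]
    | tmul h' k' => rw [hW, TensorProduct.inner_tmul]

theorem PreservesInner.injective {W : H ⊗[ℂ] K →ₗ[ℂ] L} (hW : PreservesInner W) :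
    Function.Injective W :=
  (W.isometryOfInner hW.inner_map).injective

theorem PreservesInner.norm_tmul {W : H ⊗[ℂ] K →ₗ[ℂ] L} (hW : PreservesInner W) (h : H) (k : K) :
    ‖W (h ⊗ₜ k)‖ = ‖h‖ * ‖k‖ :=
  ((W.isometryOfInner hW.inner_map).norm_map _).trans (TensorProduct.norm_tmul h k)

variable {M N M' N' P Q : Type*} [NormedAddCommGroup M] [InnerProductSpace ℂ M]
  [NormedAddCommGroup N] [InnerProductSpace ℂ N] [NormedAddCommGroup M'] [InnerProductSpace ℂ M']
  [NormedAddCommGroup N'] [InnerProductSpace ℂ N'] [NormedAddCommGroup P] [InnerProductSpace ℂ P]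
  [NormedAddCommGroup Q] [InnerProductSpace ℂ Q]

/-- The product of two maps on tensor products, after exchanging the middle factors. -/
noncomputable def interleave (f : M ⊗[ℂ] M' →ₗ[ℂ] P) (g : N ⊗[ℂ] N' →ₗ[ℂ] Q) :
    (M ⊗[ℂ] N) ⊗[ℂ] (M' ⊗[ℂ] N') →ₗ[ℂ] P ⊗[ℂ] Q :=
  TensorProduct.map f g ∘ₗ (TensorProduct.tensorTensorTensorComm ℂ M N M' N').toLinearMap

theorem interleave_tmul (f : M ⊗[ℂ] M' →ₗ[ℂ] P) (g : N ⊗[ℂ] N' →ₗ[ℂ] Q) (m : M) (n : N) (m' : M')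
    (n' : N') : interleave f g ((m ⊗ₜ n) ⊗ₜ (m' ⊗ₜ n')) = f (m ⊗ₜ m') ⊗ₜ g (n ⊗ₜ n') := rfl

theorem PreservesInner.interleave {f : M ⊗[ℂ] M' →ₗ[ℂ] P} {g : N ⊗[ℂ] N' →ₗ[ℂ] Q}
    (hf : PreservesInner f) (hg : PreservesInner g) : PreservesInner (interleave f g) := by
  intro x x' y y'
  induction x using TensorProduct.induction_on with
  | zero => simp
  | add v₁ v₂ h₁ h₂ =>
    rw [TensorProduct.add_tmul, map_add, inner_add_left, inner_add_left, h₁, h₂, add_mul]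
  | tmul m n =>
    induction x' using TensorProduct.induction_on with
    | zero => simp
    | add v₁ v₂ h₁ h₂ =>
      rw [TensorProduct.add_tmul, map_add, inner_add_right, inner_add_right, h₁, h₂, add_mul]
    | tmul p q =>
      induction y using TensorProduct.induction_on with
      | zero => simp
      | add v₁ v₂ h₁ h₂ =>
        rw [TensorProduct.tmul_add, map_add, inner_add_left, inner_add_left, h₁, h₂, mul_add]
      | tmul m' n' =>
        induction y' using TensorProduct.induction_on with
        | zero => simp
        | add v₁ v₂ h₁ h₂ =>
          rw [TensorProduct.tmul_add, map_add, inner_add_right, inner_add_right, h₁, h₂, mul_add]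
        | tmul p' q' =>
          simp only [interleave_tmul, TensorProduct.inner_tmul, hf _ _ _ _, hg _ _ _ _]
          ring

theorem interleave_map_tmul {f : M ⊗[ℂ] M' →ₗ[ℂ] P} {g : N ⊗[ℂ] N' →ₗ[ℂ] Q} {p : P →ₗ[ℂ] P}
    {q : Q →ₗ[ℂ] Q} {r : M →ₗ[ℂ] M} {s : N →ₗ[ℂ] N}
    (hf : ∀ m m', p (f (m ⊗ₜ m')) = f (r m ⊗ₜ m')) (hg : ∀ n n', q (g (n ⊗ₜ n')) = g (s n ⊗ₜ n'))
    (x : M ⊗[ℂ] N) (y : M' ⊗[ℂ] N') :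
    TensorProduct.map p q (interleave f g (x ⊗ₜ y)) =
      interleave f g (TensorProduct.map r s x ⊗ₜ y) := by
  induction x using TensorProduct.induction_on with
  | zero => simp
  | add v₁ v₂ h₁ h₂ =>
    rw [TensorProduct.add_tmul, map_add, map_add, map_add, TensorProduct.add_tmul, map_add, h₁, h₂]
  | tmul m n =>
    induction y using TensorProduct.induction_on with
    | zero => simp
    | add v₁ v₂ h₁ h₂ =>
      rw [TensorProduct.tmul_add, map_add, map_add, TensorProduct.tmul_add, map_add, h₁, h₂]
    | tmul m' n' =>
      simp only [interleave_tmul, TensorProduct.map_tmul, hf, hg]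

theorem map_tmul_eq_inv_smul (W : H ⊗[ℂ] K →ₗ[ℂ] L) {z : ℂ} (hz : z ≠ 0) (h : H) (k : K) :
    W (h ⊗ₜ k) = z⁻¹ • W ((z • h) ⊗ₜ k) := by
  rw [← TensorProduct.smul_tmul', map_smul, smul_smul, inv_mul_cancel₀ hz, one_smul]

/-- If the orbit of the image of `Ψ` is dominated by `u`, and all vectors with dominated orbits
are multiples of `ψ`, then `Ψ` is a product of `ψ` and some vector. -/
theorem PreservesInner.exists_eq_tmul [FiniteDimensional ℂ L] {V : Type*} [Fintype V]
    {F : Type*} [NormedAddCommGroup F] [InnerProductSpace ℂ F] {u : Option V → F}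
    {W : H ⊗[ℂ] K →ₗ[ℂ] L} (hW : PreservesInner W) {E : V → (H →ₗ[ℂ] H)} {E' : V → (L →ₗ[ℂ] L)}
    (hE : ∀ i h k, E' i (W (h ⊗ₜ k)) = W (E i h ⊗ₜ k)) {ψ : H}
    (hu : ∀ χ, DominatedBy u (orbitFamily E χ) → χ = ⟪ψ, χ⟫_ℂ • ψ) {Ψ : H ⊗[ℂ] K}
    (hΨ : DominatedBy u (orbitFamily E' (W Ψ))) : ∃ J : K, Ψ = ψ ⊗ₜ[ℂ] J := by
  refine exists_eq_tmul_of_sliceMap fun k => hu _ ?_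
  -- The orbit of `W Ψ` stays in the range of `W`, so any left inverse followed by a slice carries
  -- it to the orbit of that slice. Finite dimension of `L` makes this map continuous.
  obtain ⟨g, hg⟩ := W.exists_leftInverse_of_injective (LinearMap.ker_eq_bot.mpr hW.injective)
  have hg' : ∀ x, g (W x) = x := fun x => congrArg (fun F => F x) hg
  have hE' : ∀ i, E' i ∘ₗ W = W ∘ₗ (E i).rTensor K := fun i =>
    TensorProduct.ext' fun h k => hE i h k
  have := hΨ.orbitFamily_map (F := E) (LinearMap.toContinuousLinearMap (sliceMap H k ∘ₗ g))
    fun i => by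
      have h1 : E' i (W Ψ) = W ((E i).rTensor K Ψ) := congrArg (fun F => F Ψ) (hE' i)
      simp only [LinearMap.coe_toContinuousLinearMap', LinearMap.comp_apply, h1, hg',
        sliceMap_rTensor]
  simpa only [LinearMap.coe_toContinuousLinearMap', LinearMap.comp_apply, hg'] using this

end ProductIsometries

/-! ### Tensor products of kernels -/

section Range

variable {A B C A' B' C' : Type*} [AddCommGroup A] [Module ℂ A] [AddCommGroup B] [Module ℂ B]
  [AddCommGroup C] [Module ℂ C] [AddCommGroup A'] [Module ℂ A'] [AddCommGroup B'] [Module ℂ B']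
  [AddCommGroup C'] [Module ℂ C']

/-- A tensor annihilated by an operator on each factor lies in the tensor product of the
kernels. -/
theorem exists_map_eq_of_exact {fA : A →ₗ[ℂ] A'} {fB : B →ₗ[ℂ] B'} {fC : C →ₗ[ℂ] C'}
    {gA : A' →ₗ[ℂ] A'} {gB : B' →ₗ[ℂ] B'} {gC : C' →ₗ[ℂ] C'} (hA : Function.Injective fA)
    (hB : Function.Injective fB) (eA : Function.Exact fA gA)
    (eB : Function.Exact fB gB) (eC : Function.Exact fC gC) {ψ : A' ⊗[ℂ] (B' ⊗[ℂ] C')}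
    (h1 : gA.rTensor _ ψ = 0) (h2 : (gB.rTensor C').lTensor A' ψ = 0)
    (h3 : (gC.lTensor B').lTensor A' ψ = 0) :
    ∃ Ψ, TensorProduct.map fA (TensorProduct.map fB fC) Ψ = ψ := by
  obtain ⟨Ψ₁, rfl⟩ := (Module.Flat.rTensor_exact (B' ⊗[ℂ] C') eA ψ).1 h1
  have iA : ∀ (X : Type _) [AddCommGroup X] [Module ℂ X], Function.Injective (fA.rTensor X) :=
    fun X _ _ => Module.Flat.rTensor_preserves_injective_linearMap fA hA
  -- Operators on different factors commute, so the next condition is pulled back along the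
  -- injective map already split off.
  have h2' : (gB.rTensor C').lTensor A Ψ₁ = 0 := by
    apply iA
    rw [map_zero, ← h2, ← LinearMap.comp_apply, ← LinearMap.comp_apply,
      LinearMap.rTensor_comp_lTensor, LinearMap.lTensor_comp_rTensor]
  obtain ⟨Ψ₂, rfl⟩ := (Module.Flat.lTensor_exact A (Module.Flat.rTensor_exact C' eB) Ψ₁).1 h2'
  have h3' : (gC.lTensor B).lTensor A Ψ₂ = 0 := by
    apply Module.Flat.lTensor_preserves_injective_linearMap (M := A) (fB.rTensor C')
      (Module.Flat.rTensor_preserves_injective_linearMap fB hB)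
    apply iA
    rw [map_zero, map_zero, ← h3]
    have : fA.rTensor (B' ⊗[ℂ] C') ∘ₗ (fB.rTensor C').lTensor A ∘ₗ (gC.lTensor B).lTensor A =
        (gC.lTensor B').lTensor A' ∘ₗ fA.rTensor (B' ⊗[ℂ] C') ∘ₗ (fB.rTensor C').lTensor A :=
      TensorProduct.ext_threefold' fun _ _ _ => rfl
    exact congrArg (fun F => F Ψ₂) this
  obtain ⟨Ψ₃, rfl⟩ := (Module.Flat.lTensor_exact A (Module.Flat.lTensor_exact B eC) Ψ₂).1 h3'
  refine ⟨Ψ₃, ?_⟩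
  have : TensorProduct.map fA (TensorProduct.map fB fC) =
      fA.rTensor (B' ⊗[ℂ] C') ∘ₗ (fB.rTensor C').lTensor A ∘ₗ (fC.lTensor B).lTensor A :=
    TensorProduct.ext_threefold' fun _ _ _ => rfl
  exact congrArg (fun F => F Ψ₃) this

end Range

/-! ### Combinatorics of linked triples -/

section Linked

variable {ιA ιB ιC : Type*} {HA HB HC : Type*}
  [NormedAddCommGroup HA] [InnerProductSpace ℂ HA]
  [NormedAddCommGroup HB] [InnerProductSpace ℂ HB]
  [NormedAddCommGroup HC] [InnerProductSpace ℂ HC]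
  {a : ιA → HA} {b : ιB → HB} {c : ιC → HC}

theorem SharesOnly.symm {s : Party} {i j : ιA × ιB × ιC} (h : SharesOnly s i j) :
    SharesOnly s j i := by
  cases s <;> exact ⟨h.1.symm, h.2.1.symm, h.2.2.symm⟩

theorem inner_productVector (i j : ιA × ιB × ιC) :
    ⟪productVector a b c i, productVector a b c j⟫_ℂ =
      ⟪a i.1, a j.1⟫_ℂ * (⟪b i.2.1, b j.2.1⟫_ℂ * ⟪c i.2.2, c j.2.2⟫_ℂ) := by
  simp [productVector]

theorem inner_productVector_ne_zero_symm {i j : ιA × ιB × ιC}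
    (h : ⟪productVector a b c i, productVector a b c j⟫_ℂ ≠ 0) :
    ⟪productVector a b c j, productVector a b c i⟫_ℂ ≠ 0 := by
  rw [inner_productVector] at h ⊢
  simpa only [ne_eq, mul_eq_zero, inner_eq_zero_symm] using h

/-- Normal form of a linked triple. -/
theorem Linked.exists_normal_form {I : Finset (ιA × ιB × ιC)} {i j k : ιA × ιB × ιC} (hi : i ∈ I)
    (hj : j ∈ I) (hk : k ∈ I) (h : Linked a b c i j k) :
    ∃ x x' y y' z z', x ≠ x' ∧ y ≠ y' ∧ z ≠ z' ∧ (x, y, z) ∈ I ∧ (x, y', z') ∈ I ∧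
      (x', y, z') ∈ I ∧ ⟪a x, a x'⟫_ℂ ≠ 0 ∧ ⟪b y, b y'⟫_ℂ ≠ 0 ∧ ⟪c z, c z'⟫_ℂ ≠ 0 := by
  have key : ∀ {i j k : ιA × ιB × ιC}, i ∈ I → j ∈ I → k ∈ I →
      ⟪productVector a b c i, productVector a b c j⟫_ℂ ≠ 0 →
      ⟪productVector a b c i, productVector a b c k⟫_ℂ ≠ 0 →
      SharesOnly Party.A i j → SharesOnly Party.B i k → SharesOnly Party.C j k →
      ∃ x x' y y' z z', x ≠ x' ∧ y ≠ y' ∧ z ≠ z' ∧ (x, y, z) ∈ I ∧ (x, y', z') ∈ I ∧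
        (x', y, z') ∈ I ∧ ⟪a x, a x'⟫_ℂ ≠ 0 ∧ ⟪b y, b y'⟫_ℂ ≠ 0 ∧ ⟪c z, c z'⟫_ℂ ≠ 0 := by
    rintro ⟨x, y, z⟩ ⟨x₁, y', z'⟩ ⟨x', y₁, z₁⟩ hi hj hk hij hik ⟨h1, h2, h3⟩ ⟨h4, h5, h6⟩ ⟨h7, h8, h9⟩
    simp only at h1 h2 h3 h4 h5 h6 h7 h8 h9
    subst h1 h5 h9
    rw [inner_productVector] at hij hik
    exact ⟨x, x', y, y', z, z', h4, h2, h3, hi, hj, hk, left_ne_zero_of_mul hik,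
      left_ne_zero_of_mul (right_ne_zero_of_mul hij),
      right_ne_zero_of_mul (right_ne_zero_of_mul hij)⟩
  obtain ⟨-, -, -, h1, h2, h3, s, t, u, hst, hsu, htu, e1, e2, e3⟩ := h
  have h1' : ⟪productVector a b c j, productVector a b c i⟫_ℂ ≠ 0 :=
    inner_productVector_ne_zero_symm h1
  have h2' : ⟪productVector a b c k, productVector a b c i⟫_ℂ ≠ 0 :=
    inner_productVector_ne_zero_symm h2
  have h3' : ⟪productVector a b c k, productVector a b c j⟫_ℂ ≠ 0 :=
    inner_productVector_ne_zero_symm h3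
  -- Only the six assignments of distinct parties survive; each is a relabelling of the three
  -- events.
  cases s <;> cases t <;> cases u <;>
    first
    | exact absurd rfl hst
    | exact absurd rfl hsu
    | exact absurd rfl htu
    | exact key hi hj hk h1 h2 e1 e2 e3
    | exact key hj hi hk h1' h3 e1.symm e3 e2
    | exact key hi hk hj h2 h1 e2 e1 e3.symm
    | exact key hj hk hi h3 h1' e3 e1.symm e2.symm
    | exact key hk hi hj h2' h3' e2.symm e3.symm e1
    | exact key hk hj hi h3' h2' e3.symm e2.symm e1.symm

/-- A connected graph with at least two vertices has an edge, and every edge comes from a linked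
triple. -/
theorem LinkedSpanning.exists_linked {I : Finset (ιA × ιB × ιC)} {IA : Finset ιA}
    {IBC : ιA → Finset (ιB × ιC)} (h : LinkedSpanning I a b c IA IBC)
    (hd : 1 < Module.finrank ℂ HA) : ∃ i ∈ I, ∃ j ∈ I, ∃ k ∈ I, Linked a b c i j k := by
  rw [← h.card_eq, Finset.one_lt_card] at hd
  obtain ⟨x, hx, x', hx', hne⟩ := hd
  obtain ⟨p⟩ := h.connected.preconnected ⟨x, hx⟩ ⟨x', hx'⟩
  cases p with
  | nil => exact absurd rfl hne
  | cons hadj _ =>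
    obtain ⟨-, i, hi, j, hj, k, hk, hl, -⟩ := hadj
    exact ⟨i, hi, j, hj, k, hk, hl⟩

/-- Distinct indices of one setting are opposite outcomes, whose vectors are orthogonal. -/
theorem setting_ne_of_inner_ne_zero {H : Type*} [NormedAddCommGroup H] [InnerProductSpace ℂ H]
    {a : LocalIndex → H} (hao : ∀ s : Fin 2, ⟪a (0, s), a (1, s)⟫_ℂ = 0) {x x' : LocalIndex}
    (hne : x ≠ x') (h : ⟪a x, a x'⟫_ℂ ≠ 0) : x.2 ≠ x'.2 := fun h2 => by
  rcases LocalIndex.eq_or_eq_flip h2.symm with rfl | rfl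
  · exact hne rfl
  · exact h (inner_flip hao x)

end Linked

/-! ### Overlaps of the reference events and eigenvalues of the realization -/

section Norms

variable {V H K : Type*} [NormedAddCommGroup H] [InnerProductSpace ℂ H]
  [NormedAddCommGroup K] [InnerProductSpace ℂ K]

theorem eq_zero_of_tmul_eq_zero_left {x : H} {y : K} (hy : ‖y‖ = 1) (h : x ⊗ₜ[ℂ] y = 0) : x = 0 := by
  have := congrArg (sliceMap H y) h
  simpa [sliceMap_tmul, hy] using this

theorem eq_zero_of_tmul_eq_zero_right {x : H} {y : K} (hx : ‖x‖ = 1) (h : x ⊗ₜ[ℂ] y = 0) : y = 0 :=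
  eq_zero_of_tmul_eq_zero_left hx
    ((congrArg (TensorProduct.comm ℂ H K) h).trans (map_zero (TensorProduct.comm ℂ H K)))

theorem norm_weightedFamily_some {η : V → ℝ} {v : V → H} (hη : ∀ i, 0 < η i) (hv : ∀ i, ‖v i‖ = 1)
    (ψ : H) (i : V) : ‖weightedFamily ψ η v (some i)‖ = η i := by
  rw [weightedFamily, withOne, withState, norm_smul, hv, mul_one, Complex.norm_real,
    Real.norm_of_nonneg (hη i).le]

theorem norm_inner_weightedFamily_sq (η : V → ℝ) (v : V → H) (ψ : H) (i j : V) :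
    ‖⟪weightedFamily ψ η v (some i), weightedFamily ψ η v (some j)⟫_ℂ‖ ^ 2 =
      ‖⟪v i, v j⟫_ℂ‖ ^ 2 * (η j ^ 2 * η i ^ 2) := by
  simp only [weightedFamily, withOne, withState, inner_smul_left, inner_smul_right,
    norm_mul, RCLike.norm_conj, Complex.norm_real, Real.norm_eq_abs, mul_pow, sq_abs]
  ring

end Norms

section Realization

variable {HA HB HC : Type*}
  [NormedAddCommGroup HA] [InnerProductSpace ℂ HA]
  [NormedAddCommGroup HB] [InnerProductSpace ℂ HB]
  [NormedAddCommGroup HC] [InnerProductSpace ℂ HC]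

theorem actA_injective {y : HB} {z : HC} (hy : ‖y‖ = 1) (hz : ‖z‖ = 1) :
    Function.Injective (actA HA HB HC) := by
  rw [injective_iff_map_eq_zero]
  exact fun f hf => LinearMap.ext fun x =>
    eq_zero_of_tmul_eq_zero_left (y := y ⊗ₜ[ℂ] z) (by rw [TensorProduct.norm_tmul, hy, hz, one_mul])
      (congrArg (fun F => F (x ⊗ₜ (y ⊗ₜ z))) hf)

theorem actB_injective {x : HA} {z : HC} (hx : ‖x‖ = 1) (hz : ‖z‖ = 1) :
    Function.Injective (actB HA HB HC) := by
  rw [injective_iff_map_eq_zero]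
  exact fun f hf => LinearMap.ext fun y => eq_zero_of_tmul_eq_zero_left hz
    (eq_zero_of_tmul_eq_zero_right hx (congrArg (fun F => F (x ⊗ₜ (y ⊗ₜ z))) hf))

theorem actC_injective {x : HA} {y : HB} (hx : ‖x‖ = 1) (hy : ‖y‖ = 1) :
    Function.Injective (actC HA HB HC) := by
  rw [injective_iff_map_eq_zero]
  exact fun f hf => LinearMap.ext fun z => eq_zero_of_tmul_eq_zero_right hy
    (eq_zero_of_tmul_eq_zero_right hx (congrArg (fun F => F (x ⊗ₜ (y ⊗ₜ z))) hf))

variable {I : Finset TriEvent} {η : I → ℝ} {θ : I → ℂ}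
  {a : LocalIndex → HA} {b : LocalIndex → HB} {c : LocalIndex → HC}

theorem eventVector_eq_tmul (i : I) :
    eventVector θ a b c i = (θ i • a i.1.1) ⊗ₜ[ℂ] (b i.1.2.1 ⊗ₜ[ℂ] c i.1.2.2) := rfl

theorem norm_eventVector (hθ : ∀ i, ‖θ i‖ = 1) (ha : ∀ x, ‖a x‖ = 1) (hb : ∀ x, ‖b x‖ = 1)
    (hc : ∀ x, ‖c x‖ = 1) (i : I) : ‖eventVector θ a b c i‖ = 1 := by
  rw [eventVector_eq_tmul, TensorProduct.norm_tmul, TensorProduct.norm_tmul, norm_smul, hθ, ha, hb,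
    hc, one_mul, one_mul]

theorem norm_inner_eventVector_sq (hθ : ∀ i, ‖θ i‖ = 1) (i j : I) :
    ‖⟪eventVector θ a b c i, eventVector θ a b c j⟫_ℂ‖ ^ 2 =
      ‖⟪a i.1.1, a j.1.1⟫_ℂ‖ ^ 2 * (‖⟪b i.1.2.1, b j.1.2.1⟫_ℂ‖ ^ 2 *
        ‖⟪c i.1.2.2, c j.1.2.2⟫_ℂ‖ ^ 2) := by
  rw [eventVector_eq_tmul, eventVector_eq_tmul, TensorProduct.inner_tmul, TensorProduct.inner_tmul,
    inner_smul_left, inner_smul_right]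
  simp only [norm_mul, mul_pow, RCLike.norm_conj, hθ, one_mul]

variable {ψ : HA ⊗[ℂ] (HB ⊗[ℂ] HC)} {w : I → ℝ}

theorem ketBra_eventVector_comp_eq_zero (hdA : Module.finrank ℂ HA = 2)
    (hdB : Module.finrank ℂ HB = 2) (hdC : Module.finrank ℂ HC = 2) (ha : ∀ x, ‖a x‖ = 1)
    (hb : ∀ x, ‖b x‖ = 1) (hc : ∀ x, ‖c x‖ = 1) (hao : ∀ s : Fin 2, ⟪a (0, s), a (1, s)⟫_ℂ = 0)
    (hbo : ∀ s : Fin 2, ⟪b (0, s), b (1, s)⟫_ℂ = 0) (hco : ∀ s : Fin 2, ⟪c (0, s), c (1, s)⟫_ℂ = 0)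
    (hθ : ∀ i, ‖θ i‖ = 1) (i j : I) (h : (exclusivityGraph I).Adj i j) :
    ketBra (eventVector θ a b c j) ∘ₗ ketBra (eventVector θ a b c i) = 0 := by
  rw [ketBra_eventVector hθ, ketBra_eventVector hθ]
  exact productOperator_comp_eq_zero (isBinaryMeasurementPair_ketBra hdA ha hao)
    (isBinaryMeasurementPair_ketBra hdB hb hbo) (isBinaryMeasurementPair_ketBra hdC hc hco) i j h

/-- The overlaps of the two bases of each qubit are proper when the reference vectors span. -/
theorem IsUniqueThetaOptimal.overlaps_lt_one [FiniteDimensional ℂ HA] [FiniteDimensional ℂ HB]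
    [FiniteDimensional ℂ HC]
    (hX : IsUniqueThetaOptimal (exclusivityGraph I) w
      (Matrix.gram ℂ (weightedFamily ψ η (eventVector θ a b c))).transpose)
    (hdA : Module.finrank ℂ HA = 2) (hdB : Module.finrank ℂ HB = 2)
    (hdC : Module.finrank ℂ HC = 2) (ha : ∀ x, ‖a x‖ = 1)
    (hb : ∀ x, ‖b x‖ = 1) (hc : ∀ x, ‖c x‖ = 1) (hao : ∀ s : Fin 2, ⟪a (0, s), a (1, s)⟫_ℂ = 0)
    (hbo : ∀ s : Fin 2, ⟪b (0, s), b (1, s)⟫_ℂ = 0) (hco : ∀ s : Fin 2, ⟪c (0, s), c (1, s)⟫_ℂ = 0)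
    (hη : ∀ i, 0 < η i) (hθ : ∀ i, ‖θ i‖ = 1)
    (hspan : Submodule.span ℂ (Set.range (withState ψ (eventVector θ a b c))) = ⊤)
    {x x' y y' z z' : LocalIndex} (hx : x.2 ≠ x'.2) (hy : y.2 ≠ y'.2) (hz : z.2 ≠ z'.2) :
    ‖⟪a x, a x'⟫_ℂ‖ ^ 2 < 1 ∧ ‖⟪b y, b y'⟫_ℂ‖ ^ 2 < 1 ∧ ‖⟪c z, c z'⟫_ℂ‖ ^ 2 < 1 := by
  have hv := norm_eventVector hθ ha hb hc
  have he := ketBra_eventVector_comp_eq_zero hdA hdB hdC ha hb hc hao hbo hco hθ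
  have hk : ∀ i, ketBra (eventVector θ a b c i) = actA HA HB HC (ketBra (a i.1.1)) *
      actB HA HB HC (ketBra (b i.1.2.1)) * actC HA HB HC (ketBra (c i.1.2.2)) := fun i =>
    (ketBra_eventVector hθ a b c i).trans (productOperator_eq _ _ _ _)
  have hA := norm_inner_sq_lt_one (H := HA ⊗[ℂ] (HB ⊗[ℂ] HC)) hX hη hv he hspan hdA ha hao
  have hB := norm_inner_sq_lt_one (H := HA ⊗[ℂ] (HB ⊗[ℂ] HC)) hX hη hv he hspan hdB hb hbo
  have hC := norm_inner_sq_lt_one (H := HA ⊗[ℂ] (HB ⊗[ℂ] HC)) hX hη hv he hspan hdC hc hco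
  have cA : ∀ f : Module.End ℂ HA, (∀ l, Commute f (ketBra (a l))) →
      ∀ i, Commute (actA HA HB HC f) (ketBra (eventVector θ a b c i)) := fun f hf i => by
    rw [hk]
    have h1 := (hf i.1.1).map (actA HA HB HC)
    have h2 := commute_actA_actB (HC := HC) f (ketBra (b i.1.2.1))
    have h3 := commute_actA_actC (HB := HB) f (ketBra (c i.1.2.2))
    exact (h1.mul_right h2).mul_right h3
  have cB : ∀ f : Module.End ℂ HB, (∀ l, Commute f (ketBra (b l))) →
      ∀ i, Commute (actB HA HB HC f) (ketBra (eventVector θ a b c i)) := fun f hf i => by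
    rw [hk]
    have h1 := (commute_actA_actB (HC := HC) (ketBra (a i.1.1)) f).symm
    have h2 := (hf i.1.2.1).map (actB HA HB HC)
    have h3 := commute_actB_actC (HA := HA) f (ketBra (c i.1.2.2))
    exact (h1.mul_right h2).mul_right h3
  have cC : ∀ f : Module.End ℂ HC, (∀ l, Commute f (ketBra (c l))) →
      ∀ i, Commute (actC HA HB HC f) (ketBra (eventVector θ a b c i)) := fun f hf i => by
    rw [hk]
    have h1 := (commute_actA_actC (HB := HB) (ketBra (a i.1.1)) f).symm
    have h2 := (commute_actB_actC (HA := HA) (ketBra (b i.1.2.1)) f).symm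
    have h3 := (hf i.1.2.2).map (actC HA HB HC)
    exact (h1.mul_right h2).mul_right h3
  -- Injectivity needs one unit vector in each of the other spaces; the index `0` stands for `(0,
  -- 0)`, and any index would do.
  have hA' := hA (actA HA HB HC) (actA_injective (hb 0) (hc 0))
  have hB' := hB (actB HA HB HC) (actB_injective (ha 0) (hc 0))
  have hC' := hC (actC HA HB HC) (actC_injective (ha 0) (hb 0))
  exact ⟨hA' cA hx, hB' cB hy, hC' cC hz⟩

variable {HA' HB' HC' : Type*}
  [NormedAddCommGroup HA'] [InnerProductSpace ℂ HA'] [FiniteDimensional ℂ HA']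
  [NormedAddCommGroup HB'] [InnerProductSpace ℂ HB'] [FiniteDimensional ℂ HB']
  [NormedAddCommGroup HC'] [InnerProductSpace ℂ HC'] [FiniteDimensional ℂ HC']
  {ψ' : HA' ⊗[ℂ] (HB' ⊗[ℂ] HC')}
  {P : LocalIndex → (HA' →ₗ[ℂ] HA')} {Q : LocalIndex → (HB' →ₗ[ℂ] HB')}
  {R : LocalIndex → (HC' →ₗ[ℂ] HC')}

/-- For a linked triple, the state of every realization with dominated orbit is a joint
eigenvector of the local overlap operators. -/
theorem IsUniqueThetaOptimal.overlapOperator_realization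
    (hX : IsUniqueThetaOptimal (exclusivityGraph I) w
      (Matrix.gram ℂ (weightedFamily ψ η (eventVector θ a b c))).transpose)
    (ha : ∀ x, ‖a x‖ = 1) (hb : ∀ x, ‖b x‖ = 1) (hc : ∀ x, ‖c x‖ = 1)
    (hη : ∀ i, 0 < η i) (hθ : ∀ i, ‖θ i‖ = 1)
    (hP : IsBinaryMeasurementPair P) (hQ : IsBinaryMeasurementPair Q)
    (hR : IsBinaryMeasurementPair R)
    (hψ' : DominatedBy (weightedFamily ψ η (eventVector θ a b c))
      (orbitFamily (fun i : I => productOperator P Q R i.1) ψ'))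
    {x x' y y' z z' : LocalIndex} (hx : x.2 ≠ x'.2) (hy : y.2 ≠ y'.2) (hz : z.2 ≠ z'.2)
    (hi : (x, y, z) ∈ I) (hj : (x, y', z') ∈ I) (hk : (x', y, z') ∈ I)
    (ha0 : ⟪a x, a x'⟫_ℂ ≠ 0) (hb0 : ⟪b y, b y'⟫_ℂ ≠ 0) (hc0 : ⟪c z, c z'⟫_ℂ ≠ 0) :
    actA HA' HB' HC' (overlapOperator (P x) (P x')) ψ' = ((‖⟪a x, a x'⟫_ℂ‖ ^ 2 : ℝ) : ℂ) • ψ' ∧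
    actB HA' HB' HC' (overlapOperator (Q y) (Q y')) ψ' = ((‖⟪b y, b y'⟫_ℂ‖ ^ 2 : ℝ) : ℂ) • ψ' ∧
    actC HA' HB' HC' (overlapOperator (R z) (R z')) ψ' = ((‖⟪c z, c z'⟫_ℂ‖ ^ 2 : ℝ) : ℂ) • ψ' := by
  have hA := overlapOperator_map (H := HA' ⊗[ℂ] (HB' ⊗[ℂ] HC')) (actA HA' HB' HC') (P x) (P x')
  have hB := overlapOperator_map (H := HA' ⊗[ℂ] (HB' ⊗[ℂ] HC')) (actB HA' HB' HC') (Q y) (Q y')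
  have hC := overlapOperator_map (H := HA' ⊗[ℂ] (HB' ⊗[ℂ] HC')) (actC HA' HB' HC') (R z) (R z')
  have hv := norm_eventVector hθ ha hb hc
  have hne : ∀ i : I, weightedFamily ψ η (eventVector θ a b c) (some i) ≠ 0 := fun i h => by
    have := norm_weightedFamily_some hη hv ψ i
    rw [norm_eq_zero.mpr h] at this
    exact (hη i).ne this
  have hna : ∀ l, ‖⟪a l, a l⟫_ℂ‖ ^ 2 = 1 := fun l => by simp [ha]
  have hnb : ∀ l, ‖⟪b l, b l⟫_ℂ‖ ^ 2 = 1 := fun l => by simp [hb]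
  have hnc : ∀ l, ‖⟪c l, c l⟫_ℂ‖ ^ 2 = 1 := fun l => by simp [hc]
  have key := hX.overlapOperator_apply (H := HA' ⊗[ℂ] (HB' ⊗[ℂ] HC')) (E := fun i : I => productOperator P Q R i.1)
    (P := fun l => actA HA' HB' HC' (P l)) (Q := fun l => actB HA' HB' HC' (Q l))
    (R := fun l => actC HA' HB' HC' (R l)) (ev := fun i => i.1)
    (fun i => isSymmetricProjection_productOperator hP hQ hR i.1)
    (productOperator_comp_eq_zero hP hQ hR)
    (hP.map_algHom _ fun _ => isSymmetric_actA) (hQ.map_algHom _ fun _ => isSymmetric_actB)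
    (hR.map_algHom _ fun _ => isSymmetric_actC)
    (fun _ _ => commute_actA_actB _ _) (fun _ _ => commute_actA_actC _ _)
    (fun _ _ => commute_actB_actC _ _) (fun k => productOperator_eq P Q R k.1) hx hy hz
    (i := ⟨_, hi⟩) (j := ⟨_, hj⟩) (k := ⟨_, hk⟩) rfl rfl rfl
    (pow_pos (norm_pos_iff.mpr ha0) 2) (pow_pos (norm_pos_iff.mpr hb0) 2)
    (pow_pos (norm_pos_iff.mpr hc0) 2) (hne _) (hne _) (hne _) ?_ ?_ ?_ hψ'
  · exact ⟨hA ▸ key.1, hB ▸ key.2.1, hC ▸ key.2.2⟩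
  all_goals
    rw [norm_inner_weightedFamily_sq, norm_inner_eventVector_sq hθ,
      norm_weightedFamily_some hη hv, norm_weightedFamily_some hη hv]
    dsimp only
  · rw [hna, norm_inner_symm (b y'), norm_inner_symm (c z')]; ring
  · rw [hnb, norm_inner_symm (a x'), norm_inner_symm (c z')]; ring
  · rw [hnc, norm_inner_symm (a x')]; ring

end Realization

/-! ### Assembling the local isometries -/

section Extraction

variable {HA HB HC KA KB KC HA' HB' HC' : Type*}
  [NormedAddCommGroup HA] [InnerProductSpace ℂ HA] [NormedAddCommGroup HB] [InnerProductSpace ℂ HB]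
  [NormedAddCommGroup HC] [InnerProductSpace ℂ HC] [NormedAddCommGroup KA] [InnerProductSpace ℂ KA]
  [NormedAddCommGroup KB] [InnerProductSpace ℂ KB] [NormedAddCommGroup KC] [InnerProductSpace ℂ KC]
  [NormedAddCommGroup HA'] [InnerProductSpace ℂ HA'] [NormedAddCommGroup HB']
  [InnerProductSpace ℂ HB'] [NormedAddCommGroup HC'] [InnerProductSpace ℂ HC']

theorem map_regroup (f : HA ⊗[ℂ] KA →ₗ[ℂ] HA') (g : HB ⊗[ℂ] KB →ₗ[ℂ] HB')
    (h : HC ⊗[ℂ] KC →ₗ[ℂ] HC') (x : (HA ⊗[ℂ] (HB ⊗[ℂ] HC)) ⊗[ℂ] (KA ⊗[ℂ] (KB ⊗[ℂ] KC))) :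
    TensorProduct.map f (TensorProduct.map g h) (regroup HA HB HC KA KB KC x) =
      interleave f (interleave g h) x := by
  have : TensorProduct.map f (TensorProduct.map g h) ∘ₗ
      TensorProduct.map LinearMap.id (TensorProduct.tensorTensorTensorComm ℂ HB HC KB KC).toLinearMap =
      TensorProduct.map f (interleave g h) := by
    rw [← TensorProduct.map_comp, LinearMap.comp_id]
    rfl
  exact congrArg (fun F => F (TensorProduct.tensorTensorTensorComm ℂ HA (HB ⊗[ℂ] HC) KA
    (KB ⊗[ℂ] KC) x)) this

theorem AlgHom.sub_smul_one_apply_eq_zero {A H : Type*} [AddCommGroup A] [Module ℂ A]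
    [AddCommGroup H] [Module ℂ H] (φ : Module.End ℂ A →ₐ[ℂ] Module.End ℂ H) {f : Module.End ℂ A}
    {t : ℂ} {ψ : H} (h : φ f ψ = t • ψ) : φ (f - t • 1) ψ = 0 := by
  rw [map_sub, map_smul, map_one, LinearMap.sub_apply, h, LinearMap.smul_apply,
    Module.End.one_apply, sub_self]

/-- The local isometries of a realization whose state is a joint eigenvector of the local overlap
operators. -/
theorem exists_isometries_of_eigenvector [FiniteDimensional ℂ HA'] [FiniteDimensional ℂ HB']
    [FiniteDimensional ℂ HC'] (hdA : Module.finrank ℂ HA = 2)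
    (hdB : Module.finrank ℂ HB = 2) (hdC : Module.finrank ℂ HC = 2)
    {a : LocalIndex → HA} {b : LocalIndex → HB} {c : LocalIndex → HC}
    (ha : ∀ x, ‖a x‖ = 1) (hb : ∀ x, ‖b x‖ = 1) (hc : ∀ x, ‖c x‖ = 1)
    (hao : ∀ s : Fin 2, ⟪a (0, s), a (1, s)⟫_ℂ = 0) (hbo : ∀ s : Fin 2, ⟪b (0, s), b (1, s)⟫_ℂ = 0)
    (hco : ∀ s : Fin 2, ⟪c (0, s), c (1, s)⟫_ℂ = 0)
    {ψ' : HA' ⊗[ℂ] (HB' ⊗[ℂ] HC')}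
    {P : LocalIndex → (HA' →ₗ[ℂ] HA')} {Q : LocalIndex → (HB' →ₗ[ℂ] HB')}
    {R : LocalIndex → (HC' →ₗ[ℂ] HC')}
    (hP : IsBinaryMeasurementPair P) (hQ : IsBinaryMeasurementPair Q)
    (hR : IsBinaryMeasurementPair R)
    {x x' y y' z z' : LocalIndex} (hx : x.2 ≠ x'.2) (hy : y.2 ≠ y'.2) (hz : z.2 ≠ z'.2)
    (ha0 : ⟪a x, a x'⟫_ℂ ≠ 0) (hb0 : ⟪b y, b y'⟫_ℂ ≠ 0) (hc0 : ⟪c z, c z'⟫_ℂ ≠ 0)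
    (hlt : ‖⟪a x, a x'⟫_ℂ‖ ^ 2 < 1 ∧ ‖⟪b y, b y'⟫_ℂ‖ ^ 2 < 1 ∧ ‖⟪c z, c z'⟫_ℂ‖ ^ 2 < 1)
    (hev : actA HA' HB' HC' (overlapOperator (P x) (P x')) ψ' =
        ((‖⟪a x, a x'⟫_ℂ‖ ^ 2 : ℝ) : ℂ) • ψ' ∧
      actB HA' HB' HC' (overlapOperator (Q y) (Q y')) ψ' =
        ((‖⟪b y, b y'⟫_ℂ‖ ^ 2 : ℝ) : ℂ) • ψ' ∧
      actC HA' HB' HC' (overlapOperator (R z) (R z')) ψ' =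
        ((‖⟪c z, c z'⟫_ℂ‖ ^ 2 : ℝ) : ℂ) • ψ') :
    ∃ (kA kB kC : ℕ) (VA : HA ⊗[ℂ] EuclideanSpace ℂ (Fin kA) →ₗᵢ[ℂ] HA')
      (VB : HB ⊗[ℂ] EuclideanSpace ℂ (Fin kB) →ₗᵢ[ℂ] HB')
      (VC : HC ⊗[ℂ] EuclideanSpace ℂ (Fin kC) →ₗᵢ[ℂ] HC')
      (Ψ : (HA ⊗[ℂ] (HB ⊗[ℂ] HC)) ⊗[ℂ] (EuclideanSpace ℂ (Fin kA) ⊗[ℂ]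
        (EuclideanSpace ℂ (Fin kB) ⊗[ℂ] EuclideanSpace ℂ (Fin kC)))),
      interleave VA.toLinearMap (interleave VB.toLinearMap VC.toLinearMap) Ψ = ψ' ∧
      ∀ (i : TriEvent) (h : HA ⊗[ℂ] (HB ⊗[ℂ] HC)) (k : EuclideanSpace ℂ (Fin kA) ⊗[ℂ]
        (EuclideanSpace ℂ (Fin kB) ⊗[ℂ] EuclideanSpace ℂ (Fin kC))),
        productOperator P Q R i
          (interleave VA.toLinearMap (interleave VB.toLinearMap VC.toLinearMap) (h ⊗ₜ k)) =
        interleave VA.toLinearMap (interleave VB.toLinearMap VC.toLinearMap)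
          (productOperator (fun x => ketBra (a x)) (fun x => ketBra (b x)) (fun x => ketBra (c x))
            i h ⊗ₜ k) := by
  obtain ⟨kA, VA, iA, eA⟩ := hP.exists_isometry hdA ha hao hx rfl (pow_pos (norm_pos_iff.mpr ha0) 2)
    hlt.1
  obtain ⟨kB, VB, iB, eB⟩ := hQ.exists_isometry hdB hb hbo hy rfl (pow_pos (norm_pos_iff.mpr hb0) 2)
    hlt.2.1
  obtain ⟨kC, VC, iC, eC⟩ := hR.exists_isometry hdC hc hco hz rfl (pow_pos (norm_pos_iff.mpr hc0) 2)
    hlt.2.2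
  -- The ranges of the three isometries are the eigenspaces of the overlap operators, so the three
  -- eigenvector equations put `ψ'` in their tensor product.
  obtain ⟨Ψ₀, hΨ₀⟩ := exists_map_eq_of_exact VA.injective VB.injective eA eB eC
    ((actA HA' HB' HC').sub_smul_one_apply_eq_zero hev.1)
    ((actB HA' HB' HC').sub_smul_one_apply_eq_zero hev.2.1)
    ((actC HA' HB' HC').sub_smul_one_apply_eq_zero hev.2.2)
  obtain ⟨Ψ, rfl⟩ := (regroup HA HB HC (EuclideanSpace ℂ (Fin kA)) (EuclideanSpace ℂ (Fin kB))
    (EuclideanSpace ℂ (Fin kC))).surjective Ψ₀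
  rw [map_regroup] at hΨ₀
  refine ⟨kA, kB, kC, VA, VB, VC, Ψ, hΨ₀, fun i h k => ?_⟩
  exact interleave_map_tmul (fun m m' => congrArg (fun F => F (m ⊗ₜ m')) (iA i.1))
    (fun n n' => interleave_map_tmul (fun m m' => congrArg (fun F => F (m ⊗ₜ m')) (iB i.2.1))
      (fun m m' => congrArg (fun F => F (m ⊗ₜ m')) (iC i.2.2)) n n') h k

end Extraction

theorem theorem5
    -- the ideal systems are qubits
    {HA HB HC : Type*}
    [NormedAddCommGroup HA] [InnerProductSpace ℂ HA]
    [NormedAddCommGroup HB] [InnerProductSpace ℂ HB]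
    [NormedAddCommGroup HC] [InnerProductSpace ℂ HC]
    (hdA : Module.finrank ℂ HA = 2) (hdB : Module.finrank ℂ HB = 2)
    (hdC : Module.finrank ℂ HC = 2)
    -- the events of the Bell witness and their weights
    (I : Finset TriEvent) (w : I → ℝ) (hw : ∀ i, 0 < w i)
    -- the reference state and local vectors; each measurement is an orthonormal pair
    (ψ : HA ⊗[ℂ] (HB ⊗[ℂ] HC)) (hψ : ‖ψ‖ = 1)
    (a : LocalIndex → HA) (b : LocalIndex → HB) (c : LocalIndex → HC)
    (ha : ∀ x, ‖a x‖ = 1) (hb : ∀ x, ‖b x‖ = 1) (hc : ∀ x, ‖c x‖ = 1)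
    (hao : ∀ s : Fin 2, ⟪a (0, s), a (1, s)⟫_ℂ = 0)
    (hbo : ∀ s : Fin 2, ⟪b (0, s), b (1, s)⟫_ℂ = 0)
    (hco : ∀ s : Fin 2, ⟪c (0, s), c (1, s)⟫_ℂ = 0)
    (η : I → ℝ) (hη : ∀ i, 0 < η i)
    (θ : I → ℂ) (hθ : ∀ i, ‖θ i‖ = 1)
    -- the reference matrix is the unique optimal solution of the theta program
    (hopt : IsUniqueThetaOptimal (exclusivityGraph I) w
      (referenceMatrix ψ η (eventVector θ a b c)))
    -- the spanning and connectedness conditions on the reference vectors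
    (hspan : Submodule.span ℂ (Set.range (withState ψ (eventVector θ a b c))) = ⊤)
    (hcond : ∃ (IA : Finset LocalIndex) (IBC : LocalIndex → Finset (LocalIndex × LocalIndex)),
      LinkedSpanning I a b c IA IBC ∧
      OverlapSpanning {p : LocalIndex × LocalIndex | ∃ x ∈ IA, p ∈ IBC x} b c)
    -- another realization, with local projections of arbitrary rank
    {HA' HB' HC' : Type*}
    [NormedAddCommGroup HA'] [InnerProductSpace ℂ HA'] [FiniteDimensional ℂ HA']
    [NormedAddCommGroup HB'] [InnerProductSpace ℂ HB'] [FiniteDimensional ℂ HB']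
    [NormedAddCommGroup HC'] [InnerProductSpace ℂ HC'] [FiniteDimensional ℂ HC']
    (ψ' : HA' ⊗[ℂ] (HB' ⊗[ℂ] HC')) (hψ' : ‖ψ'‖ = 1)
    (P : LocalIndex → (HA' →ₗ[ℂ] HA')) (Q : LocalIndex → (HB' →ₗ[ℂ] HB'))
    (R : LocalIndex → (HC' →ₗ[ℂ] HC'))
    (hP : IsBinaryMeasurementPair P) (hQ : IsBinaryMeasurementPair Q)
    (hR : IsBinaryMeasurementPair R)
    -- which is optimal
    (hopt' : IsThetaOptimal (exclusivityGraph I) w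
      (realizationMatrix ψ' (fun i : I => productOperator P Q R i.1))) :
    ∃ (kA kB kC : ℕ)
      (VA : HA ⊗[ℂ] EuclideanSpace ℂ (Fin kA) →ₗᵢ[ℂ] HA')
      (VB : HB ⊗[ℂ] EuclideanSpace ℂ (Fin kB) →ₗᵢ[ℂ] HB')
      (VC : HC ⊗[ℂ] EuclideanSpace ℂ (Fin kC) →ₗᵢ[ℂ] HC')
      (junk : EuclideanSpace ℂ (Fin kA) ⊗[ℂ]
        (EuclideanSpace ℂ (Fin kB) ⊗[ℂ] EuclideanSpace ℂ (Fin kC))),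
      ‖junk‖ = 1 ∧
      TensorProduct.map VA.toLinearMap (TensorProduct.map VB.toLinearMap VC.toLinearMap)
          (regroup HA HB HC _ _ _ (ψ ⊗ₜ[ℂ] junk)) = ψ' ∧
      ∀ i : I,
        TensorProduct.map VA.toLinearMap (TensorProduct.map VB.toLinearMap VC.toLinearMap)
            (regroup HA HB HC _ _ _ (eventVector θ a b c i ⊗ₜ[ℂ] junk)) =
          ((η i)⁻¹ : ℂ) • productOperator P Q R i.1 ψ' := by
  have : FiniteDimensional ℂ HA := FiniteDimensional.of_finrank_pos (by omega)
  have : FiniteDimensional ℂ HB := FiniteDimensional.of_finrank_pos (by omega)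
  have : FiniteDimensional ℂ HC := FiniteDimensional.of_finrank_pos (by omega)
  rw [referenceMatrix_eq_gram] at hopt
  have hE : ∀ i : I, LinearMap.IsSymmetric (𝕜 := ℂ) (E := HA' ⊗[ℂ] (HB' ⊗[ℂ] HC'))
      (productOperator P Q R i.1) := fun i =>
    (isSymmetricProjection_productOperator hP hQ hR i.1).isSymmetric
  have hdom : DominatedBy (weightedFamily ψ η (eventVector θ a b c))
      (orbitFamily (fun i : I => productOperator P Q R i.1) ψ') := by
    -- Uniqueness makes the two Gram matrices equal, which gives domination with constant one.
    have h := hopt.2 _ hopt'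
    rw [realizationMatrix_eq_gram ψ' hE] at h
    exact .of_gram_eq (Matrix.transpose_injective h)
  obtain ⟨IA, IBC, hl, -⟩ := hcond
  obtain ⟨i, hi, j, hj, k, hk, hlink⟩ := hl.exists_linked (by omega)
  obtain ⟨x, x', y, y', z, z', hx, hy, hz, hi, hj, hk, ha0, hb0, hc0⟩ :=
    hlink.exists_normal_form hi hj hk
  have hx := setting_ne_of_inner_ne_zero hao hx ha0
  have hy := setting_ne_of_inner_ne_zero hbo hy hb0
  have hz := setting_ne_of_inner_ne_zero hco hz hc0
  have hlt := hopt.overlaps_lt_one hdA hdB hdC ha hb hc hao hbo hco hη hθ hspan hx hy hz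
  have hev := hopt.overlapOperator_realization ha hb hc hη hθ hP hQ hR hdom hx hy hz hi hj hk
    ha0 hb0 hc0
  obtain ⟨kA, kB, kC, VA, VB, VC, Ψ, hΨ, hW⟩ := exists_isometries_of_eigenvector hdA hdB hdC ha hb
    hc hao hbo hco hP hQ hR hx hy hz ha0 hb0 hc0 hlt hev
  have hin : PreservesInner (interleave VA.toLinearMap
      (interleave VB.toLinearMap VC.toLinearMap)) :=
    VA.preservesInner.interleave (VB.preservesInner.interleave VC.preservesInner)
  have hv := norm_eventVector hθ ha hb hc
  have he := ketBra_eventVector_comp_eq_zero hdA hdB hdC ha hb hc hao hbo hco hθ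
  have hW' : ∀ (i : I) h k, productOperator P Q R i.1
      (interleave VA.toLinearMap (interleave VB.toLinearMap VC.toLinearMap) (h ⊗ₜ k)) =
      interleave VA.toLinearMap (interleave VB.toLinearMap VC.toLinearMap)
        (ketBra (eventVector θ a b c i) h ⊗ₜ k) := fun i h k => by
    rw [hW, ketBra_eventVector hθ]
  -- The isometries turn the event projections into `|v_i⟩⟨v_i| ⊗ 1`, so the slices of `Ψ` are
  -- vectors of the reference system with dominated orbits.
  obtain ⟨J, rfl⟩ := hin.exists_eq_tmul hW' (fun χ => hopt.eq_smul_state hη hv he hspan)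
    (by rw [hΨ]; exact hdom)
  refine ⟨kA, kB, kC, VA, VB, VC, J, ?_, (map_regroup _ _ _ _).trans hΨ, fun i => ?_⟩
  · have h := hin.norm_tmul ψ J
    rw [hΨ, hψ, hψ', one_mul] at h
    exact h.symm
  -- The projection of `ψ ⊗ J` for the event `i` is `η_i v_i ⊗ J`, whence the factor `η_i⁻¹`.
  · rw [map_regroup, ← hΨ, hW', ketBra_apply, hopt.inner_state hη hv]
    have h0 : (η i : ℂ) ≠ 0 := by exact_mod_cast (hη i).ne'
    exact map_tmul_eq_inv_smul (interleave VA.toLinearMap (interleave VB.toLinearMap VC.toLinearMap))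
      h0 (eventVector θ a b c i) J
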